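/- Let $\omega^*$ be the set of nonprincipal ultrafilters on $\omega$, i.e. the remainder of $\beta\omega$. Let $\mathbb{M}=\omega\times[0,1]$ be the topological sum of countably many copies of the unit interval, let $q:\mathbb{M}\to\omega$ be the projection, let $\beta q:\beta\mathbb{M}\to\beta\omega$ be its continuous extension, and for $u\in\omega^*$ let $\mathbb{I}_u=(\beta q)^{-1}(u)$. Let $\mathbb{H}=[0,\infty)$ and $\mathbb{H}^*=\beta\mathbb{H}\setminus\mathbb{H}$. A standard subcontinuum of $\mathbb{H}^*$ is a set of the form $$I_u=\bigcap_{U\in u}\mathrm{cl}_{\beta\mathbb{H}}\Bigl(\bigcup_{n\in U}I_n\Bigr),$$ where $u\in\omega^*$ and $(I_n)_{n\in\omega}$ is a discrete sequence of nondegenerate compact intervals in $\mathbb{H}$ (discrete: every point of $\mathbb{H}$ has a neighbourhood that meets $I_n$ for at most one $n$). **Theorem.** The Continuum Hypothesis $2^{\aleph_0}=\aleph_1$ is equivalent to the statement that all standard subcontinua are homeomorphic to each other, for both usual descriptions of these continua: 1. $2^{\aleph_0}=\aleph_1$ if and only if $\mathbb{I}_u$ and $\mathbb{I}_v$ are homeomorphic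 for all $u,v\in\omega^*$; 2. $2^{\aleph_0}=\aleph_1$ if and only if any two standard subcontinua of $\mathbb{H}^*$ are homeomorphic. -/

import Mathlib

open scoped NNReal Topology

/-- The Continuum Hypothesis: `2 ^ ℵ₀ = ℵ₁`. -/
def ContinuumHypothesis : Prop :=
  Cardinal.continuum.{0} = Cardinal.aleph 1

/-- `ω*`, the space of nonprincipal ultrafilters on `ℕ`
(the remainder of `βω = Ultrafilter ℕ`). -/
abbrev OmegaStar : Type :=
  {u : Ultrafilter ℕ // u ∉ Set.range (pure : ℕ → Ultrafilter ℕ)}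

/-- `𝕄 = ω × [0,1]`, the topological sum of countably many copies of the unit interval. -/
abbrev Mioid : Type := ℕ × unitInterval

/-- The projection `q : 𝕄 → ω`, as a map into `βω`. -/
def mioidProj (p : Mioid) : Ultrafilter ℕ := pure p.1

theorem continuous_mioidProj : Continuous mioidProj :=
  (continuous_of_discreteTopology (f := (pure : ℕ → Ultrafilter ℕ))).comp continuous_fst

/-- `βq : β𝕄 → βω`, the continuous extension of `q`. -/
noncomputable def betaMioidProj : StoneCech Mioid → Ultrafilter ℕ :=
  stoneCechExtend continuous_mioidProj

/-- The continuum `𝕀_u`: the fiber of `u ∈ ω*` under `βq`. -/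
def IFiber (u : OmegaStar) : Set (StoneCech Mioid) :=
  betaMioidProj ⁻¹' {u.1}

/-- `ℍ* = βℍ ∖ ℍ`, the Čech–Stone remainder of the half line `ℍ = [0,∞)`. -/
abbrev HalfLineStar : Type :=
  {p : StoneCech ℝ≥0 // p ∉ Set.range (stoneCechUnit : ℝ≥0 → StoneCech ℝ≥0)}

/-- A sequence of subsets is discrete if every point has a neighbourhood that meets
at most one of its members. -/
def IsDiscreteSeq {X : Type*} [TopologicalSpace X] (I : ℕ → Set X) : Prop :=
  ∀ x : X, ∃ V ∈ 𝓝 x, {n : ℕ | (I n ∩ V).Nonempty}.Subsingleton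

/-- `I_u = ⋂_{U ∈ u} cl (⋃_{n ∈ U} I_n)`, with closures taken in `βℍ`, as a subset of `ℍ*`. -/
def ultraLimit (I : ℕ → Set ℝ≥0) (u : OmegaStar) : Set HalfLineStar :=
  {p | ∀ U ∈ u.1, p.1 ∈ closure (stoneCechUnit '' ⋃ n ∈ U, I n)}

/-- A standard subcontinuum of `ℍ*`: a set of the form `I_u`, for a discrete sequence of
nondegenerate compact intervals `I_n = [a_n, b_n]` of `ℍ` and a point `u` of `ω*`. -/
def IsStandardSubcontinuum (S : Set HalfLineStar) : Prop :=
  ∃ (a b : ℕ → ℝ≥0) (u : OmegaStar), (∀ n, a n < b n) ∧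
    IsDiscreteSeq (fun n => Set.Icc (a n) (b n)) ∧
    S = ultraLimit (fun n => Set.Icc (a n) (b n)) u

/-!
Write `𝕀_u` for the fiber of `β(ω × [0,1])` over `u ∈ ω*`. All that is used of it is the structure
`IsFiberLattice`: the traces on `𝕀_u` of the closed subsets of `ω × [0,1]` form a base for its
closed sets, in which emptiness and covering are decided by the fibers over almost all `n`, modulo
`u`. In other words, `𝕀_u` is the Wallman space of the ultrapower modulo `u` of the lattice of
closed subsets of `[0,1]`. A standard subcontinuum `I_u` of `ℍ*` carries the same structure, since a
discrete union of intervals is a closed copy of `ω × [0,1]` in `ℍ`; hence `I_u` is homeomorphic to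
`𝕀_u` (`nonempty_homeomorph_ultraLimit_IFiber`), and both equivalences amount to the same.

Under the Continuum Hypothesis the ultrapowers of the lattice of closed subsets of `[0,1]` have
cardinality `ℵ₁`, are countably saturated (`exists_forall_eventually_of_finite`) and elementarily
equivalent. A back-and-forth argument of length `ω₁` (`exists_isPartialElementary_total`) shows that
they are isomorphic, and an isomorphism induces a homeomorphism of the fibers
(`nonempty_homeomorph_of_continuumHypothesis`).

For the converse, consider the coinitiality of the infinite elements of the ultrapower `ω^ω / u`.
For every regular `κ` with `ℵ₀ < κ ≤ 2 ^ ℵ₀` some `u` makes it `κ`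
(`exists_ultrafilter_coinitial`): start with `κ` independent functions `f i` and a filter `D` that
is maximal among the filters modulo which they are independent. Then a set of natural numbers is
determined, modulo `D`, by an initial segment of the family, and one builds the ultrafilter in `κ`
steps, placing `f i` below all functions that are determined by the earlier functions and have been
made infinite. If the Continuum Hypothesis fails, both `ℵ₁` and `ℵ₂` occur as coinitialities.

This coinitiality is visible in the topology of `𝕀_u`. The ultrapower of `[0,1]` modulo `u` embeds
as a dense set of points of `𝕀_u`, its intervals correspond to connected sets, and all its members
except the end points are cut points. The cut points are thereby linearly ordered, with
betweenness given by separation (`IsFiberLattice.below_of_separates`), and any two of them have a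
member of the ultrapower in between. So a strictly monotone sequence of cut points can be separated
from every family of `ℵ₁` cut points beyond it (the property `SequencesSeparated`) when the
coinitiality is `ℵ₂`, but not when it is `ℵ₁`.
-/

namespace StandardSubcontinua

open Set Filter

/-! ### Bases for the closed sets and homeomorphisms -/

section Criterion

variable {ι X Y : Type*}

/-- The points of a compact space correspond to the maximal filters of a base for the closed sets;
transferring such a filter along `F i ↦ G i` yields a point of the other space. -/
theorem exists_forall_mem_of_families [TopologicalSpace Y] [CompactSpace Y]
    {F : ι → Set X} {G : ι → Set Y}
    (hG : ∀ i, IsClosed (G i)) (htop : ∃ i, F i = univ)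
    (hinter : ∀ i j, ∃ k, F k = F i ∩ F j ∧ G k = G i ∩ G j)
    (hempty : ∀ i, G i = ∅ → F i = ∅) (x : X) : ∃ y, ∀ i, x ∈ F i → y ∈ G i := by
  obtain ⟨i₀, hi₀⟩ := htop
  have : Nonempty {i // x ∈ F i} := ⟨⟨i₀, by simp [hi₀]⟩⟩
  have key : (⋂ i : {i // x ∈ F i}, G i).Nonempty := by
    refine IsCompact.nonempty_iInter_of_directed_nonempty_isCompact_isClosed _ ?_ ?_
      (fun i => (hG i).isCompact) (fun i => hG i)
    · rintro ⟨i, hi⟩ ⟨j, hj⟩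
      obtain ⟨k, hk, hk'⟩ := hinter i j
      refine ⟨⟨k, by rw [hk]; exact ⟨hi, hj⟩⟩, ?_, ?_⟩
      · change G k ⊆ G i
        rw [hk']; exact inter_subset_left
      · change G k ⊆ G j
        rw [hk']; exact inter_subset_right
    · rintro ⟨i, hi⟩
      rw [nonempty_iff_ne_empty]
      intro h
      simp [hempty i h] at hi
  obtain ⟨y, hy⟩ := key
  exact ⟨y, fun i hi => mem_iInter.1 hy ⟨i, hi⟩⟩

variable [TopologicalSpace X] [TopologicalSpace Y]

/-- A map that respects two separating families with the same binary covers is continuous. -/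
theorem continuous_of_families [CompactSpace Y] {F : ι → Set X} {G : ι → Set Y}
    (hF : ∀ i, IsClosed (F i)) (hG : ∀ i, IsClosed (G i))
    (hcov : ∀ i j, G i ∪ G j = univ → F i ∪ F j = univ)
    (hsep : ∀ p q : Y, p ≠ q → ∃ i j, p ∉ G i ∧ q ∉ G j ∧ G i ∪ G j = univ)
    {f : X → Y} (hf : ∀ x i, x ∈ F i → f x ∈ G i) : Continuous f := by
  refine continuous_iff_continuousAt.2 fun x => ?_
  -- By compactness of `Y` it suffices that `f x` is the only cluster point of `f` at `x`.
  refine le_nhds_of_unique_clusterPt fun y hy => ?_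
  by_contra hne
  obtain ⟨i, j, hi, hj, hij⟩ := hsep y (f x) hne
  have hx : x ∉ F j := fun h => hj (hf x j h)
  have h1 : ∀ᶠ z in 𝓝 x, f z ∈ G i := by
    filter_upwards [(hF j).isOpen_compl.mem_nhds hx] with z hz
    have : z ∈ F i ∪ F j := by rw [hcov i j hij]; trivial
    exact hf z i (this.resolve_right hz)
  have h2 : y ∈ closure (G i) := by
    rw [mem_closure_iff_clusterPt]
    exact hy.mono (le_principal_iff.2 h1)
  exact hi ((hG i).closure_eq ▸ h2)

/-- Compact Hausdorff spaces with bases for the closed sets, indexed by the same set, are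
homeomorphic if the two bases have the same intersections, the same empty members and
the same binary covers. -/
theorem nonempty_homeomorph_of_families [CompactSpace X] [CompactSpace Y]
    {F : ι → Set X} {G : ι → Set Y}
    (hF : ∀ i, IsClosed (F i)) (hG : ∀ i, IsClosed (G i))
    (htop : ∃ i, F i = univ ∧ G i = univ)
    (hinter : ∀ i j, ∃ k, F k = F i ∩ F j ∧ G k = G i ∩ G j)
    (hempty : ∀ i, F i = ∅ ↔ G i = ∅)
    (hcov : ∀ i j, F i ∪ F j = univ ↔ G i ∪ G j = univ)
    (hsepF : ∀ p q : X, p ≠ q → ∃ i j, p ∉ F i ∧ q ∉ F j ∧ F i ∪ F j = univ)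
    (hsepG : ∀ p q : Y, p ≠ q → ∃ i j, p ∉ G i ∧ q ∉ G j ∧ G i ∪ G j = univ) :
    Nonempty (X ≃ₜ Y) := by
  obtain ⟨i₀, h₀, h₀'⟩ := htop
  choose f hf using exists_forall_mem_of_families hG ⟨i₀, h₀⟩ hinter fun i => (hempty i).2
  choose g hg using exists_forall_mem_of_families hF ⟨i₀, h₀'⟩
    (fun i j => (hinter i j).imp fun _ h => ⟨h.2, h.1⟩) fun i => (hempty i).1
  refine ⟨{ toFun := f, invFun := g, left_inv := fun x => ?_, right_inv := fun y => ?_,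
            continuous_toFun := continuous_of_families hF hG (fun i j => (hcov i j).2) hsepG hf,
            continuous_invFun := continuous_of_families hG hF (fun i j => (hcov i j).1) hsepF hg }⟩
  · by_contra hne
    obtain ⟨i, j, hi, hj, hij⟩ := hsepF _ _ hne
    have : x ∈ F i ∪ F j := by rw [hij]; trivial
    exact hi (hg _ _ (hf _ _ (this.resolve_right hj)))
  · by_contra hne
    obtain ⟨i, j, hi, hj, hij⟩ := hsepG _ _ hne
    have : y ∈ G i ∪ G j := by rw [hij]; trivial
    exact hi (hf _ _ (hg _ _ (this.resolve_right hj)))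

end Criterion

/-! ### Traces of closed sets on a fiber -/

/-- `F` represents the closed subsets of `𝕄 = ω × [0,1]` modulo `u` as a base for the closed sets
of `X`. This is what remains of `F C = cl C ∩ 𝕀_u` when one forgets the Čech–Stone
compactification. -/
structure IsFiberLattice (u : Ultrafilter ℕ) {X : Type*} [TopologicalSpace X]
    (F : Set Mioid → Set X) : Prop where
  isClosed : ∀ C, IsClosed C → IsClosed (F C)
  inter : ∀ C D, IsClosed C → IsClosed D → F (C ∩ D) = F C ∩ F D
  union : ∀ C D, F (C ∪ D) = F C ∪ F D
  eq_empty_iff : ∀ C, IsClosed C → (F C = ∅ ↔ ∀ᶠ n in u, Prod.mk n ⁻¹' C = ∅)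
  eq_univ : ∀ C, IsClosed C → (∀ᶠ n in u, Prod.mk n ⁻¹' C = univ) → F C = univ
  separates : ∀ p q, p ≠ q → ∃ C D, IsClosed C ∧ IsClosed D ∧ C ∪ D = univ ∧ p ∉ F C ∧ q ∉ F D

theorem isClosed_mioid_iff {C : Set Mioid} : IsClosed C ↔ ∀ n, IsClosed (Prod.mk n ⁻¹' C) := by
  constructor
  · intro h n
    exact h.preimage (by fun_prop)
  · intro h
    rw [← isOpen_compl_iff, isOpen_prod_iff]
    intro n t ht
    refine ⟨{n}, (Prod.mk n ⁻¹' C)ᶜ, isOpen_discrete _, (h n).isOpen_compl, rfl, ht, ?_⟩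
    rintro ⟨m, s⟩ ⟨hm, hs⟩
    obtain rfl : m = n := hm
    exact hs

namespace IsFiberLattice

variable {u : Ultrafilter ℕ} {X : Type*} [TopologicalSpace X] {F : Set Mioid → Set X}

theorem subset_iff (hF : IsFiberLattice u F) {C D : Set Mioid} (hC : IsClosed C)
    (hD : IsClosed D) : F C ⊆ F D ↔ ∀ᶠ n in u, Prod.mk n ⁻¹' C ⊆ Prod.mk n ⁻¹' D := by
  constructor
  · intro h
    by_contra hcon
    rw [← Ultrafilter.eventually_not] at hcon
    -- A selector of `C \ D` over a large set of indices has a nonempty trace outside that of `D`.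
    have hx : ∀ n, ∃ x : unitInterval, ¬ (Prod.mk n ⁻¹' C ⊆ Prod.mk n ⁻¹' D) →
        (n, x) ∈ C ∧ (n, x) ∉ D := by
      intro n
      by_cases hn : Prod.mk n ⁻¹' C ⊆ Prod.mk n ⁻¹' D
      · exact ⟨0, fun h => absurd hn h⟩
      · obtain ⟨x, h1, h2⟩ := not_subset.1 hn
        exact ⟨x, fun _ => ⟨h1, h2⟩⟩
    choose x hx using hx
    set E : Set Mioid := {p | ¬ (Prod.mk p.1 ⁻¹' C ⊆ Prod.mk p.1 ⁻¹' D) ∧ p.2 = x p.1} with hE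
    have hEc : IsClosed E := by
      rw [isClosed_mioid_iff]
      intro n
      exact (Set.Subsingleton.isClosed (fun a ha b hb => ha.2.trans hb.2.symm))
    have hEC : E ⊆ C := by
      rintro ⟨n, t⟩ ⟨h1, h2⟩
      obtain rfl : t = x n := h2
      exact (hx n h1).1
    have hED : E ∩ D = ∅ := by
      rw [eq_empty_iff_forall_notMem]
      rintro ⟨n, t⟩ ⟨⟨h1, h2⟩, h3⟩
      obtain rfl : t = x n := h2
      exact (hx n h1).2 h3
    have h1 : F E ⊆ F D := by
      refine Subset.trans ?_ h
      rw [← inter_eq_self_of_subset_left hEC, hF.inter _ _ hEc hC]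
      exact inter_subset_right
    have h2 : F E = ∅ := by
      rw [← inter_eq_self_of_subset_left h1, ← hF.inter _ _ hEc hD, hED]
      exact (hF.eq_empty_iff ∅ isClosed_empty).2 (by simp)
    rw [hF.eq_empty_iff E hEc] at h2
    obtain ⟨n, h3, h4⟩ := (h2.and hcon).exists
    have : x n ∈ Prod.mk n ⁻¹' E := ⟨h4, rfl⟩
    simp [h3] at this
  · intro h
    have h1 : F C ⊆ F (C ∩ D ∪ {p | ¬ (Prod.mk p.1 ⁻¹' C ⊆ Prod.mk p.1 ⁻¹' D)}) := by
      have : C ∩ D ∪ {p | ¬ (Prod.mk p.1 ⁻¹' C ⊆ Prod.mk p.1 ⁻¹' D)} =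
          C ∪ (C ∩ D ∪ {p | ¬ (Prod.mk p.1 ⁻¹' C ⊆ Prod.mk p.1 ⁻¹' D)}) := by
        refine (union_eq_self_of_subset_left ?_).symm
        rintro ⟨n, t⟩ hp
        by_cases hn : Prod.mk n ⁻¹' C ⊆ Prod.mk n ⁻¹' D
        · exact Or.inl ⟨hp, hn hp⟩
        · exact Or.inr hn
      rw [this, hF.union]
      exact subset_union_left
    have h2 : F {p | ¬ (Prod.mk p.1 ⁻¹' C ⊆ Prod.mk p.1 ⁻¹' D)} = ∅ := by
      refine (hF.eq_empty_iff _ ?_).2 ?_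
      · rw [isClosed_mioid_iff]
        intro n
        by_cases hn : Prod.mk n ⁻¹' C ⊆ Prod.mk n ⁻¹' D <;> simp [hn]
      · filter_upwards [h] with n hn
        ext t
        simp [hn]
    rw [hF.union, h2, union_empty, hF.inter _ _ hC hD] at h1
    exact h1.trans inter_subset_right

theorem eq_univ_iff (hF : IsFiberLattice u F) {C : Set Mioid} (hC : IsClosed C) :
    F C = univ ↔ ∀ᶠ n in u, Prod.mk n ⁻¹' C = univ := by
  refine ⟨fun h => ?_, hF.eq_univ C hC⟩
  have := (hF.subset_iff isClosed_univ hC).1 (by rw [h]; exact subset_univ _)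
  filter_upwards [this] with n hn
  exact univ_subset_iff.1 hn

theorem eq_of_eventuallyEq (hF : IsFiberLattice u F) {C D : Set Mioid} (hC : IsClosed C)
    (hD : IsClosed D) (h : ∀ᶠ n in u, Prod.mk n ⁻¹' C = Prod.mk n ⁻¹' D) : F C = F D :=
  Subset.antisymm ((hF.subset_iff hC hD).2 (h.mono fun _ h => h.subset))
    ((hF.subset_iff hD hC).2 (h.mono fun _ h => h.symm.subset))

/-- Fiber lattices can be transported along homeomorphisms. -/
theorem preimage {Y : Type*} [TopologicalSpace Y] (hF : IsFiberLattice u F) (e : Y ≃ₜ X) :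
    IsFiberLattice u (fun C => e ⁻¹' F C) where
  isClosed C hC := (hF.isClosed C hC).preimage e.continuous
  inter C D hC hD := by rw [hF.inter C D hC hD, preimage_inter]
  union C D := by rw [hF.union C D, preimage_union]
  eq_empty_iff C hC := by
    rw [← hF.eq_empty_iff C hC, preimage_eq_empty_iff, e.surjective.range_eq, disjoint_univ]
  eq_univ C hC h := by rw [hF.eq_univ C hC h, preimage_univ]
  separates p q hpq := hF.separates (e p) (e q) (e.injective.ne hpq)

end IsFiberLattice

/-- Spaces whose closed bases represent the closed subsets of `𝕄` modulo the same ultrafilter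
are homeomorphic. -/
theorem nonempty_homeomorph_of_isFiberLattice {u : Ultrafilter ℕ} {X Y : Type*}
    [TopologicalSpace X] [TopologicalSpace Y] [CompactSpace X] [CompactSpace Y]
    {F : Set Mioid → Set X} {G : Set Mioid → Set Y}
    (hF : IsFiberLattice u F) (hG : IsFiberLattice u G) : Nonempty (X ≃ₜ Y) := by
  refine nonempty_homeomorph_of_families (ι := {C : Set Mioid // IsClosed C})
    (F := fun C => F C) (G := fun C => G C) (fun i => hF.isClosed i i.2)
    (fun i => hG.isClosed i i.2) ⟨⟨univ, isClosed_univ⟩, ?_, ?_⟩ (fun C D => ?_) (fun C => ?_)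
    (fun C D => ?_) (fun p q hpq => ?_) (fun p q hpq => ?_)
  · exact hF.eq_univ _ isClosed_univ (by simp)
  · exact hG.eq_univ _ isClosed_univ (by simp)
  · exact ⟨⟨C ∩ D, C.2.inter D.2⟩, hF.inter _ _ C.2 D.2, hG.inter _ _ C.2 D.2⟩
  · rw [hF.eq_empty_iff _ C.2, hG.eq_empty_iff _ C.2]
  · rw [← hF.union, ← hG.union, hF.eq_univ_iff (C.2.union D.2), hG.eq_univ_iff (C.2.union D.2)]
  · obtain ⟨C, D, hC, hD, h, hp, hq⟩ := hF.separates p q hpq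
    exact ⟨⟨C, hC⟩, ⟨D, hD⟩, hp, hq, by
      rw [← hF.union, h]; exact hF.eq_univ _ isClosed_univ (by simp)⟩
  · obtain ⟨C, D, hC, hD, h, hp, hq⟩ := hG.separates p q hpq
    exact ⟨⟨C, hC⟩, ⟨D, hD⟩, hp, hq, by
      rw [← hG.union, h]; exact hG.eq_univ _ isClosed_univ (by simp)⟩

/-! ### Fibers in Čech–Stone compactifications -/

section StoneCech

variable {Z : Type*} [TopologicalSpace Z]

theorem disjoint_closure_image_stoneCechUnit [NormalSpace Z] {A B : Set Z} (hA : IsClosed A)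
    (hB : IsClosed B) (hAB : Disjoint A B) :
    Disjoint (closure (stoneCechUnit '' A)) (closure (stoneCechUnit '' B)) := by
  obtain ⟨f, h0, h1, h01⟩ := exists_continuous_zero_one_of_isClosed hA hB hAB
  let g : Z → unitInterval := fun z => ⟨f z, h01 z⟩
  have hg : Continuous g := by fun_prop
  have hcA : closure (stoneCechUnit '' A) ⊆ stoneCechExtend hg ⁻¹' {0} := by
    refine closure_minimal ?_ (isClosed_singleton.preimage (continuous_stoneCechExtend hg))
    rintro _ ⟨z, hz, rfl⟩
    simp only [mem_preimage, stoneCechExtend_stoneCechUnit, mem_singleton_iff]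
    exact Subtype.ext (h0 hz)
  have hcB : closure (stoneCechUnit '' B) ⊆ stoneCechExtend hg ⁻¹' {1} := by
    refine closure_minimal ?_ (isClosed_singleton.preimage (continuous_stoneCechExtend hg))
    rintro _ ⟨z, hz, rfl⟩
    simp only [mem_preimage, stoneCechExtend_stoneCechUnit, mem_singleton_iff]
    exact Subtype.ext (h1 hz)
  refine Set.disjoint_left.2 fun p hpA hpB => ?_
  have h1 := hcA hpA
  have h2 := hcB hpB
  simp only [mem_preimage, mem_singleton_iff] at h1 h2
  exact zero_ne_one (h1.symm.trans h2)

theorem mem_closure_image_inter {α β : Type*} [TopologicalSpace β] {f : α → β} {A : Set α}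
    {N : Set β} {p : β} (hp : p ∈ closure (f '' A)) (hN : N ∈ 𝓝 p) :
    p ∈ closure (f '' (A ∩ f ⁻¹' N)) := by
  rw [mem_closure_iff_nhds] at hp ⊢
  intro V hV
  obtain ⟨_, ⟨h1, h2⟩, z, hz, rfl⟩ := hp _ (inter_mem hV hN)
  exact ⟨f z, h1, z, ⟨hz, h2⟩, rfl⟩

theorem closure_image_stoneCechUnit_inter [NormalSpace Z] {A B : Set Z} (hA : IsClosed A)
    (hB : IsClosed B) : closure (stoneCechUnit '' (A ∩ B)) =
      closure (stoneCechUnit '' A) ∩ closure (stoneCechUnit '' B) := by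
  refine Subset.antisymm (subset_inter (closure_mono (image_mono inter_subset_left))
    (closure_mono (image_mono inter_subset_right))) ?_
  rintro p ⟨hpA, hpB⟩
  by_contra hp
  obtain ⟨N, hN, hNc, hNd⟩ :=
    exists_mem_nhds_isClosed_subset (isClosed_closure.isOpen_compl.mem_nhds hp)
  have hNcl : IsClosed (stoneCechUnit ⁻¹' N : Set Z) := hNc.preimage continuous_stoneCechUnit
  refine Set.disjoint_left.1 (disjoint_closure_image_stoneCechUnit (hA.inter hNcl)
    (hB.inter hNcl) (Set.disjoint_left.2 ?_)) (mem_closure_image_inter hpA hN)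
    (mem_closure_image_inter hpB hN)
  rintro z ⟨hzA, hzN⟩ ⟨hzB, -⟩
  exact hNd hzN (subset_closure ⟨z, ⟨hzA, hzB⟩, rfl⟩)

/-- The fiber over `u` of a copy of `𝕄` in `Z`: the intersection of the closures in `βZ` of the
sets `h (U × [0,1])` for `U ∈ u`. -/
def betaFiber (h : Mioid → Z) (u : Ultrafilter ℕ) : Set (StoneCech Z) :=
  {p | ∀ U ∈ u, p ∈ closure (stoneCechUnit '' (h '' (Prod.fst ⁻¹' U)))}

/-- The trace on `betaFiber h u` of the closure of `h '' C`. -/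
def betaTrace (h : Mioid → Z) (u : Ultrafilter ℕ) (C : Set Mioid) : Set (betaFiber h u) :=
  {p | p.1 ∈ closure (stoneCechUnit '' (h '' C))}

theorem isClosed_betaFiber (h : Mioid → Z) (u : Ultrafilter ℕ) : IsClosed (betaFiber h u) := by
  have : betaFiber h u = ⋂ U ∈ u, closure (stoneCechUnit '' (h '' (Prod.fst ⁻¹' U))) := by
    ext p; simp [betaFiber]
  rw [this]
  exact isClosed_biInter fun _ _ => isClosed_closure

instance (h : Mioid → Z) (u : Ultrafilter ℕ) : CompactSpace (betaFiber h u) :=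
  isCompact_iff_compactSpace.1 (isClosed_betaFiber h u).isCompact

theorem isFiberLattice_betaTrace [NormalSpace Z] {h : Mioid → Z} (hh : Topology.IsClosedEmbedding h)
    (u : Ultrafilter ℕ) : IsFiberLattice u (betaTrace h u) where
  isClosed C _ := isClosed_closure.preimage continuous_subtype_val
  inter C D hC hD := by
    ext p
    simp only [betaTrace, image_inter hh.injective, mem_ofPred_eq, mem_inter_iff,
      closure_image_stoneCechUnit_inter (hh.isClosedMap _ hC) (hh.isClosedMap _ hD)]
  union C D := by
    ext p
    simp [betaTrace, image_union, closure_union]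
  eq_empty_iff C hC := by
    constructor
    · intro hE
      by_contra hcon
      rw [← Ultrafilter.eventually_not] at hcon
      have hcl : ∀ U : Set ℕ, IsClosed (C ∩ Prod.fst ⁻¹' U) := fun U =>
        hC.inter ((isClosed_discrete U).preimage continuous_fst)
      have key : (⋂ U : {U // U ∈ u},
          closure (stoneCechUnit '' (h '' (C ∩ Prod.fst ⁻¹' U.1)))).Nonempty := by
        have : Nonempty {U // U ∈ u} := ⟨⟨univ, univ_mem⟩⟩
        refine IsCompact.nonempty_iInter_of_directed_nonempty_isCompact_isClosed _ ?_ ?_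
          (fun i => isClosed_closure.isCompact) (fun i => isClosed_closure)
        · rintro ⟨U, hU⟩ ⟨V, hV⟩
          refine ⟨⟨U ∩ V, inter_mem hU hV⟩, ?_, ?_⟩
          · change closure _ ⊆ closure _
            gcongr
            exact inter_subset_left
          · change closure _ ⊆ closure _
            gcongr
            exact inter_subset_right
        · rintro ⟨U, hU⟩
          obtain ⟨n, hn, hnU⟩ := (hcon.and hU).exists
          obtain ⟨t, ht⟩ := nonempty_iff_ne_empty.2 hn
          exact Nonempty.closure ⟨_, _, ⟨(n, t), ⟨ht, hnU⟩, rfl⟩, rfl⟩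
      obtain ⟨p, hp⟩ := key
      rw [mem_iInter] at hp
      have hpX : p ∈ betaFiber h u := fun U hU =>
        closure_mono (image_mono (image_mono inter_subset_right)) (hp ⟨U, hU⟩)
      have : (⟨p, hpX⟩ : betaFiber h u) ∈ betaTrace h u C :=
        closure_mono (image_mono (image_mono inter_subset_left)) (hp ⟨univ, univ_mem⟩)
      rw [hE] at this
      exact this
    · intro hE
      rw [eq_empty_iff_forall_notMem]
      rintro ⟨p, hp⟩ hpC
      have h1 := hp _ hE
      have h2 : p ∈ closure (stoneCechUnit '' (h '' C)) := hpC
      refine Set.disjoint_left.1 (disjoint_closure_image_stoneCechUnit (hh.isClosedMap _ hC)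
        (hh.isClosedMap _ ((isClosed_discrete _).preimage continuous_fst)) ?_) h2 h1
      refine disjoint_image_of_injective hh.injective (Set.disjoint_left.2 ?_)
      rintro ⟨n, t⟩ h3 (h4 : Prod.mk n ⁻¹' C = ∅)
      have : t ∈ Prod.mk n ⁻¹' C := h3
      rw [h4] at this
      exact this
  eq_univ C hC hE := by
    rw [eq_univ_iff_forall]
    rintro ⟨p, hp⟩
    refine closure_mono (image_mono (image_mono ?_)) (hp _ hE)
    rintro ⟨n, t⟩ (h1 : Prod.mk n ⁻¹' C = univ)
    have : t ∈ Prod.mk n ⁻¹' C := by rw [h1]; trivial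
    exact this
  separates p q hpq := by
    have hne : p.1 ≠ q.1 := fun h => hpq (Subtype.ext h)
    obtain ⟨f, h0, h1, -⟩ := exists_continuous_zero_one_of_isClosed
      (isClosed_singleton (x := p.1)) (isClosed_singleton (x := q.1)) (by simpa using hne)
    have hc : Continuous fun x => f (stoneCechUnit (h x)) :=
      f.continuous.comp (continuous_stoneCechUnit.comp hh.continuous)
    refine ⟨{x | (1 / 2 : ℝ) ≤ f (stoneCechUnit (h x))},
      {x | f (stoneCechUnit (h x)) ≤ (1 / 2 : ℝ)},
      isClosed_le continuous_const hc, isClosed_le hc continuous_const, ?_, ?_, ?_⟩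
    · ext x
      simpa using le_total _ _
    · intro hp
      have : p.1 ∈ {y | (1 / 2 : ℝ) ≤ f y} := by
        refine closure_minimal ?_ (isClosed_le continuous_const f.continuous) hp
        rintro _ ⟨_, ⟨x, hx, rfl⟩, rfl⟩
        exact hx
      have h2 : f p.1 = 0 := h0 rfl
      rw [mem_ofPred_eq, h2] at this
      norm_num at this
    · intro hq
      have : q.1 ∈ {y | f y ≤ (1 / 2 : ℝ)} := by
        refine closure_minimal ?_ (isClosed_le f.continuous continuous_const) hq
        rintro _ ⟨_, ⟨x, hx, rfl⟩, rfl⟩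
        exact hx
      have h2 : f q.1 = 1 := h1 rfl
      rw [mem_ofPred_eq, h2] at this
      norm_num at this

end StoneCech

theorem IFiber_eq_betaFiber (u : OmegaStar) : IFiber u = betaFiber id u.1 := by
  have hc : Continuous betaMioidProj := continuous_stoneCechExtend continuous_mioidProj
  have key : ∀ (U : Set ℕ) (p : StoneCech Mioid),
      p ∈ closure (stoneCechUnit '' (id '' (Prod.fst ⁻¹' U))) → U ∈ betaMioidProj p := by
    intro U p hp
    refine closure_minimal (t := betaMioidProj ⁻¹' {w | U ∈ w}) ?_
      ((ultrafilter_isClosed_basic U).preimage hc) hp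
    rintro _ ⟨_, ⟨⟨n, t⟩, hx, rfl⟩, rfl⟩
    have : betaMioidProj (stoneCechUnit (id (n, t))) = mioidProj (n, t) :=
      stoneCechExtend_stoneCechUnit continuous_mioidProj _
    rw [mem_preimage, this]
    exact hx
  ext p
  constructor
  · intro (hp : betaMioidProj p = u.1) U hU
    have hp' : p ∈ closure (stoneCechUnit '' (id '' (Prod.fst ⁻¹' U : Set Mioid))) ∪
        closure (stoneCechUnit '' (id '' (Prod.fst ⁻¹' Uᶜ : Set Mioid))) := by
      rw [← closure_union, ← image_union, ← image_union, ← preimage_union, union_compl_self,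
        preimage_univ, image_id, image_univ, denseRange_stoneCechUnit.closure_range]
      trivial
    refine hp'.resolve_right fun h => ?_
    have := key _ _ h
    rw [hp] at this
    exact Ultrafilter.compl_mem_iff_notMem.1 this hU
  · intro hp
    change betaMioidProj p = u.1
    exact Ultrafilter.eq_of_le fun U hU => key U p (hp U hU)

theorem exists_isFiberLattice_IFiber (u : OmegaStar) : CompactSpace (IFiber u) ∧
    ∃ F : Set Mioid → Set (IFiber u), IsFiberLattice u.1 F := by
  rw [IFiber_eq_betaFiber]
  exact ⟨inferInstance, _, isFiberLattice_betaTrace .id u.1⟩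

/-! ### Standard subcontinua of the remainder of the half line -/

section HalfLine

variable {a b : ℕ → ℝ≥0}

/-- The map `𝕄 → ℍ` that sends `{n} × [0,1]` affinely onto `[a n, b n]`. -/
noncomputable def intervalMap (a b : ℕ → ℝ≥0) (p : Mioid) : ℝ≥0 :=
  a p.1 + unitInterval.toNNReal p.2 * (b p.1 - a p.1)

theorem image_intervalMap_fiber (hab : ∀ n, a n < b n) (n : ℕ) :
    range (fun t => intervalMap a b (n, t)) = Icc (a n) (b n) := by
  have hpos : 0 < b n - a n := tsub_pos_of_lt (hab n)
  ext x
  constructor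
  · rintro ⟨t, rfl⟩
    refine ⟨le_self_add, ?_⟩
    calc a n + unitInterval.toNNReal t * (b n - a n) ≤ a n + 1 * (b n - a n) := by
          gcongr
          exact t.2.2
      _ = b n := by rw [one_mul, add_tsub_cancel_of_le (hab n).le]
  · rintro ⟨h1, h2⟩
    have h3 : (x - a n) / (b n - a n) ≤ 1 := by
      rw [div_le_one hpos]
      exact tsub_le_tsub_right h2 _
    refine ⟨⟨((x - a n) / (b n - a n) : ℝ≥0), NNReal.coe_nonneg _, by exact_mod_cast h3⟩, ?_⟩
    have : unitInterval.toNNReal (⟨((x - a n) / (b n - a n) : ℝ≥0), NNReal.coe_nonneg _,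
        by exact_mod_cast h3⟩ : unitInterval) = (x - a n) / (b n - a n) := by
      ext; rfl
    simp only [intervalMap, this]
    rw [div_mul_cancel₀ _ hpos.ne', add_tsub_cancel_of_le h1]

theorem eq_of_mem_of_isDiscreteSeq {X : Type*} [TopologicalSpace X] {I : ℕ → Set X}
    (hI : IsDiscreteSeq I) {x : X} {m n : ℕ} (hm : x ∈ I m) (hn : x ∈ I n) : m = n := by
  obtain ⟨V, hV, hs⟩ := hI x
  exact hs ⟨x, hm, mem_of_mem_nhds hV⟩ ⟨x, hn, mem_of_mem_nhds hV⟩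

theorem locallyFinite_of_isDiscreteSeq {X : Type*} [TopologicalSpace X] {I : ℕ → Set X}
    (hI : IsDiscreteSeq I) : LocallyFinite I := fun x => by
  obtain ⟨V, hV, hs⟩ := hI x
  exact ⟨V, hV, hs.finite⟩

theorem isClosedEmbedding_intervalMap (hab : ∀ n, a n < b n)
    (hI : IsDiscreteSeq fun n => Icc (a n) (b n)) :
    Topology.IsClosedEmbedding (intervalMap a b) := by
  have hmem : ∀ n t, intervalMap a b (n, t) ∈ Icc (a n) (b n) := fun n t => by
    rw [← image_intervalMap_fiber hab n]; exact ⟨t, rfl⟩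
  have hcont : Continuous (intervalMap a b) := by
    have ha : Continuous fun p : Mioid => a p.1 :=
      continuous_of_discreteTopology.comp continuous_fst
    have hb : Continuous fun p : Mioid => b p.1 :=
      continuous_of_discreteTopology.comp continuous_fst
    have ht : Continuous fun p : Mioid => unitInterval.toNNReal p.2 :=
      unitInterval.toNNReal_continuous.comp continuous_snd
    exact ha.add (ht.mul (hb.sub ha))
  refine .of_continuous_injective_isClosedMap hcont ?_ ?_
  · rintro ⟨m, s⟩ ⟨n, t⟩ hst
    obtain rfl : m = n := eq_of_mem_of_isDiscreteSeq hI (hmem m s) (hst ▸ hmem n t)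
    have hpos : 0 < b m - a m := tsub_pos_of_lt (hab m)
    have h1 := mul_right_cancel₀ hpos.ne' (add_left_cancel hst)
    have h2 : s = t := Subtype.ext (congrArg NNReal.toReal h1)
    rw [h2]
  · intro C hC
    have : intervalMap a b '' C = ⋃ n, (fun t => intervalMap a b (n, t)) '' (Prod.mk n ⁻¹' C) := by
      ext x
      simp only [mem_image, Prod.exists, mem_iUnion, mem_preimage]
    rw [this]
    refine LocallyFinite.isClosed_iUnion ?_ fun n => ?_
    · refine (locallyFinite_of_isDiscreteSeq hI).subset fun n => ?_
      rintro _ ⟨t, -, rfl⟩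
      exact hmem n t
    · exact ((isClosed_mioid_iff.1 hC n).isCompact.image
        (hcont.comp (by fun_prop : Continuous (Prod.mk n)))).isClosed

theorem image_intervalMap (hab : ∀ n, a n < b n) (U : Set ℕ) :
    intervalMap a b '' (Prod.fst ⁻¹' U) = ⋃ n ∈ U, Icc (a n) (b n) := by
  ext x
  simp only [mem_image, Prod.exists, mem_preimage, mem_iUnion, exists_prop]
  constructor
  · rintro ⟨n, t, hn, rfl⟩
    refine ⟨n, hn, ?_⟩
    rw [← image_intervalMap_fiber hab n]
    exact ⟨t, rfl⟩
  · rintro ⟨n, hn, hx⟩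
    rw [← image_intervalMap_fiber hab n] at hx
    obtain ⟨t, rfl⟩ := hx
    exact ⟨n, t, hn, rfl⟩

/-- Because the intervals form a discrete sequence and `u` is nonprincipal, the fiber over `u`
contains no point of the half line itself. -/
theorem notMem_range_of_mem_betaFiber (hab : ∀ n, a n < b n)
    (hI : IsDiscreteSeq fun n => Icc (a n) (b n)) (u : OmegaStar) {p : StoneCech ℝ≥0}
    (hp : p ∈ betaFiber (intervalMap a b) u.1) :
    p ∉ range (stoneCechUnit : ℝ≥0 → StoneCech ℝ≥0) := by
  rintro ⟨z, rfl⟩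
  obtain ⟨V, hV, hs⟩ := hI z
  have hU : {n | (Icc (a n) (b n) ∩ V).Nonempty}ᶜ ∈ u.1 := by
    rw [Ultrafilter.compl_mem_iff_notMem]
    intro h
    obtain ⟨n, -, hn⟩ := Ultrafilter.eq_pure_of_finite_mem hs.finite h
    exact u.2 ⟨n, hn.symm⟩
  have h1 := hp _ hU
  rw [image_intervalMap hab, ← mem_preimage,
    ← isEmbedding_stoneCechUnit.isInducing.closure_eq_preimage_closure_image] at h1
  obtain ⟨x, hxV, hx⟩ := mem_closure_iff_nhds.1 h1 V hV
  simp only [mem_iUnion] at hx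
  obtain ⟨n, hn, hx⟩ := hx
  exact hn ⟨x, hx, hxV⟩

/-- A standard subcontinuum, as a subset of `ℍ*`, is a copy of the corresponding fiber in `βℍ`. -/
noncomputable def ultraLimitHomeomorph (hab : ∀ n, a n < b n)
    (hI : IsDiscreteSeq fun n => Icc (a n) (b n)) (u : OmegaStar) :
    ultraLimit (fun n => Icc (a n) (b n)) u ≃ₜ betaFiber (intervalMap a b) u.1 where
  toFun p := ⟨p.1.1, fun U hU => by rw [image_intervalMap hab]; exact p.2 U hU⟩
  invFun p := ⟨⟨p.1, notMem_range_of_mem_betaFiber hab hI u p.2⟩, fun U hU => by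
    have := p.2 U hU
    rwa [image_intervalMap hab] at this⟩
  left_inv _ := rfl
  right_inv _ := rfl
  continuous_toFun := by fun_prop
  continuous_invFun := by fun_prop

/-- Every standard subcontinuum `I_u` is homeomorphic to `𝕀_u`. -/
theorem nonempty_homeomorph_ultraLimit_IFiber (hab : ∀ n, a n < b n)
    (hI : IsDiscreteSeq fun n => Icc (a n) (b n)) (u : OmegaStar) :
    Nonempty (ultraLimit (fun n => Icc (a n) (b n)) u ≃ₜ IFiber u) := by
  obtain ⟨_, F, hF⟩ := exists_isFiberLattice_IFiber u
  obtain ⟨e⟩ := nonempty_homeomorph_of_isFiberLattice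
    (isFiberLattice_betaTrace (isClosedEmbedding_intervalMap hab hI) u.1) hF
  exact ⟨(ultraLimitHomeomorph hab hI u).trans e⟩

theorem isDiscreteSeq_Icc_even :
    IsDiscreteSeq fun n : ℕ => Icc (2 * n : ℝ≥0) (2 * n + 1) := by
  intro x
  refine ⟨Metric.ball x (1 / 2), Metric.ball_mem_nhds _ (by norm_num), ?_⟩
  rintro m ⟨y, ⟨hy1, hy2⟩, hy⟩ n ⟨z, ⟨hz1, hz2⟩, hz⟩
  rw [Metric.mem_ball, NNReal.dist_eq, abs_lt] at hy hz
  have h1 : (2 * m : ℝ) ≤ y := by exact_mod_cast hy1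
  have h2 : (y : ℝ) ≤ 2 * m + 1 := by exact_mod_cast hy2
  have h3 : (2 * n : ℝ) ≤ z := by exact_mod_cast hz1
  have h4 : (z : ℝ) ≤ 2 * n + 1 := by exact_mod_cast hz2
  have h5 : (m : ℝ) < n + 1 := by linarith [hy.1, hy.2, hz.1, hz.2]
  have h6 : (n : ℝ) < m + 1 := by linarith [hy.1, hy.2, hz.1, hz.2]
  have h7 : m < n + 1 := by exact_mod_cast h5
  have h8 : n < m + 1 := by exact_mod_cast h6
  omega

end HalfLine

/-! ### Back and forth between ultrapowers -/

theorem le_atTop_of_omegaStar (u : OmegaStar) : (u.1 : Filter ℕ) ≤ atTop := by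
  rw [← Nat.cofinite_eq_atTop, Filter.le_cofinite_iff_eventually_ne]
  intro n
  by_contra h
  rw [← Ultrafilter.eventually_not] at h
  obtain ⟨m, -, hm⟩ := Ultrafilter.eq_pure_of_finite_mem (finite_singleton n)
    (h.mono fun k hk => not_not.1 hk)
  exact u.2 ⟨m, hm.symm⟩

/-- Countable saturation of ultrapowers: a countable type that is finitely satisfiable almost
everywhere is realized by a single sequence. -/
theorem exists_forall_eventually_of_finite {M : Type*} [Nonempty M] {v : Filter ℕ}
    (hv : v ≤ atTop) {R : ℕ → ℕ → M → Prop}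
    (h : ∀ k, ∀ᶠ n in v, ∃ z, ∀ j ≤ k, R j n z) : ∃ y : ℕ → M, ∀ j, ∀ᶠ n in v, R j n (y n) := by
  classical
  -- At coordinate `n` satisfy as many of the first `n` conditions as possible.
  let K : ℕ → ℕ := fun n => Nat.findGreatest (fun k => ∃ z, ∀ j ≤ k, R j n z) n
  have hy : ∀ n, ∃ y, (∃ z, ∀ j ≤ K n, R j n z) → ∀ j ≤ K n, R j n y := by
    intro n
    by_cases hn : ∃ z, ∀ j ≤ K n, R j n z
    · exact hn.imp fun y hy _ => hy
    · exact ⟨Classical.arbitrary M, fun h => absurd h hn⟩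
  choose y hy using hy
  refine ⟨y, fun k => ?_⟩
  filter_upwards [h k, hv (eventually_ge_atTop k)] with n hn hkn
  exact hy n (Nat.findGreatest_spec (P := fun k => ∃ z, ∀ j ≤ k, R j n z) hkn hn) k
    (Nat.le_findGreatest hkn hn)

section BackAndForth

open FirstOrder

variable (L : Language) {M : Type*} [L.Structure M]

/-- The set `S` of pairs of sequences is a partial elementary map between the ultrapowers of `M`
modulo `u` and modulo `v`. By Łoś's theorem, satisfaction in an ultrapower is expressed by
satisfaction in almost all coordinates. -/
def IsPartialElementary (u v : Ultrafilter ℕ) (S : Set ((ℕ → M) × (ℕ → M))) : Prop :=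
  ∀ s : ℕ → (ℕ → M) × (ℕ → M), (∀ k, s k ∈ S) → ∀ φ : L.Formula ℕ,
    (∀ᶠ n in u, φ.Realize fun k => (s k).1 n) ↔ ∀ᶠ n in v, φ.Realize fun k => (s k).2 n

variable {L} {u v : Ultrafilter ℕ} {S T : Set ((ℕ → M) × (ℕ → M))}

theorem IsPartialElementary.mono (hS : IsPartialElementary L u v S) (h : T ⊆ S) :
    IsPartialElementary L u v T := fun s hs => hS s fun k => h (hs k)

theorem IsPartialElementary.swap (hS : IsPartialElementary L u v S) :
    IsPartialElementary L v u (Prod.swap '' S) := fun s hs φ => by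
  refine (hS (fun k => (s k).swap) (fun k => ?_) φ).symm
  obtain ⟨p, hp, h⟩ := hs k
  rwa [← h, Prod.swap_swap]

theorem isPartialElementary_singleton_const (c : M) :
    IsPartialElementary L u v {((fun _ => c), fun _ => c)} := fun s hs φ => by
  have h1 : ∀ k, s k = ((fun _ => c), fun _ => c) := hs
  simp [h1]

theorem realize_congr_of_freeVarFinset {φ : L.Formula ℕ} {a b : ℕ → M}
    (h : ∀ k, k ∈ φ.freeVarFinset → a k = b k) : φ.Realize a ↔ φ.Realize b := by
  unfold Language.Formula.Realize
  rw [← Language.BoundedFormula.realize_restrictFreeVar' Subset.rfl (v := a),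
    ← Language.BoundedFormula.realize_restrictFreeVar' Subset.rfl (v := b)]
  have : a ∘ (Subtype.val : {k // k ∈ (φ.freeVarFinset : Set ℕ)} → ℕ) =
      b ∘ (Subtype.val : {k // k ∈ (φ.freeVarFinset : Set ℕ)} → ℕ) := by
    funext k; exact h k k.2
  rw [this]

/-- A formula has finitely many variables, so being partial elementary is of finite character. -/
theorem isPartialElementary_of_finite {c : (ℕ → M) × (ℕ → M)} (hc : c ∈ S)
    (h : ∀ T ⊆ S, T.Finite → c ∈ T → IsPartialElementary L u v T) :
    IsPartialElementary L u v S := by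
  classical
  intro s hs φ
  let s' : ℕ → (ℕ → M) × (ℕ → M) := fun k => if k ∈ φ.freeVarFinset then s k else c
  have h1 : ∀ k, k ∈ φ.freeVarFinset → s k = s' k := fun k hk => by simp [s', hk]
  have hT := h (insert c (s '' φ.freeVarFinset)) ?_ ?_ (mem_insert _ _) s' ?_ φ
  · rw [← eventually_congr (Eventually.of_forall fun n => realize_congr_of_freeVarFinset fun k hk =>
        congrArg (fun p => p.1 n) (h1 k hk)), ← eventually_congr (Eventually.of_forall fun n =>
        realize_congr_of_freeVarFinset fun k hk => congrArg (fun p => p.2 n) (h1 k hk))] at hT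
    exact hT
  · rintro _ (rfl | ⟨k, -, rfl⟩)
    · exact hc
    · exact hs k
  · exact (φ.freeVarFinset.finite_toSet.image s).insert c
  · intro k
    by_cases hk : k ∈ φ.freeVarFinset
    · exact Or.inr ⟨k, hk, h1 k hk⟩
    · simp [s', hk]

variable [Countable L.Symbols] [Nonempty M]

/-- The forth step: the type of `x` over the countable domain of a partial elementary map is
transferred to the other ultrapower, and realized there by countable saturation. -/
theorem IsPartialElementary.exists_insert (hv : (v : Filter ℕ) ≤ atTop)
    (hS : IsPartialElementary L u v S) (hc : S.Countable) (hne : S.Nonempty) (x : ℕ → M) :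
    ∃ y, IsPartialElementary L u v (insert (x, y) S) := by
  obtain ⟨s, rfl⟩ := hc.exists_eq_range hne
  let cons : M → (ℕ → M) → ℕ → M := fun z a k => Nat.casesOn k z a
  set Φ : Set (L.Formula ℕ) :=
    {φ | ∀ᶠ n in u, φ.Realize (cons (x n) fun k => (s k).1 n)} with hΦ
  have hΦne : Φ.Nonempty := ⟨⊤, by simp [hΦ]⟩
  obtain ⟨e, he⟩ := (to_countable Φ).exists_eq_range hΦne
  let r : ℕ → ℕ ⊕ Unit := fun i => Nat.casesOn i (Sum.inr ()) Sum.inl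
  let ψ : ℕ → L.Formula ℕ := fun k =>
    ((Language.Formula.iInf fun j : Fin (k + 1) => e j).relabel r).iExs Unit
  have hψ : ∀ k (a : ℕ → M), (ψ k).Realize a ↔ ∃ z, ∀ j ≤ k, (e j).Realize (cons z a) := by
    intro k a
    have hr : ∀ i : Unit → M, Sum.elim a i ∘ r = cons (i ()) a := by
      intro i; funext n; cases n <;> rfl
    simp only [ψ, Language.Formula.realize_iExs, Language.Formula.realize_relabel,
      Language.Formula.realize_iInf, hr]
    constructor
    · rintro ⟨i, hi⟩
      exact ⟨i (), fun j hj => hi ⟨j, by omega⟩⟩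
    · rintro ⟨z, hz⟩
      exact ⟨fun _ => z, fun j => hz j (by omega)⟩
  have hex : ∀ k, ∀ᶠ n in v, ∃ z, ∀ j ≤ k, (e j).Realize (cons z fun k => (s k).2 n) := by
    intro k
    have h1 : ∀ᶠ n in u, (ψ k).Realize fun k => (s k).1 n := by
      have h2 : ∀ᶠ n in u, ∀ j ∈ Finset.range (k + 1),
          (e j).Realize (cons (x n) fun k => (s k).1 n) := by
        rw [Finset.eventually_all]
        intro j _
        have : e j ∈ Φ := he ▸ mem_range_self j
        exact this
      filter_upwards [h2] with n hn
      exact (hψ k _).2 ⟨x n, fun j hj => hn j (Finset.mem_range.2 (by omega))⟩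
    exact ((hS s (fun k => mem_range_self k) (ψ k)).1 h1).mono fun n hn => (hψ k _).1 hn
  obtain ⟨y, hy⟩ := exists_forall_eventually_of_finite hv hex
  have key : ∀ φ : L.Formula ℕ, (∀ᶠ n in u, φ.Realize (cons (x n) fun k => (s k).1 n)) →
      ∀ᶠ n in v, φ.Realize (cons (y n) fun k => (s k).2 n) := by
    intro φ hφ
    have : φ ∈ range e := he ▸ hφ
    obtain ⟨j, rfl⟩ := this
    exact hy j
  refine ⟨y, fun t ht φ => ?_⟩
  have ht' : ∀ k, ∃ i, (∀ n, (t k).1 n = cons (x n) (fun k => (s k).1 n) i) ∧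
      ∀ n, (t k).2 n = cons (y n) (fun k => (s k).2 n) i := by
    intro k
    rcases ht k with h | ⟨i, h⟩
    · exact ⟨0, by simp [h, cons], by simp [h, cons]⟩
    · exact ⟨i + 1, by simp [← h, cons], by simp [← h, cons]⟩
  choose ρ h1 h2 using ht'
  have e1 : ∀ n (θ : L.Formula ℕ), (θ.Realize fun k => (t k).1 n) ↔
      (θ.relabel ρ).Realize (cons (x n) fun k => (s k).1 n) := fun n θ => by
    rw [Language.Formula.realize_relabel]
    exact iff_of_eq (congrArg _ (funext fun k => h1 k n))
  have e2 : ∀ n (θ : L.Formula ℕ), (θ.Realize fun k => (t k).2 n) ↔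
      (θ.relabel ρ).Realize (cons (y n) fun k => (s k).2 n) := fun n θ => by
    rw [Language.Formula.realize_relabel]
    exact iff_of_eq (congrArg _ (funext fun k => h2 k n))
  have key' : ∀ θ : L.Formula ℕ, (∀ᶠ n in u, θ.Realize fun k => (t k).1 n) →
      ∀ᶠ n in v, θ.Realize fun k => (t k).2 n := fun θ h => by
    simp only [e1] at h
    simp only [e2]
    exact key _ h
  refine ⟨key' φ, fun h => ?_⟩
  by_contra hcon
  rw [← Ultrafilter.eventually_not] at hcon
  obtain ⟨n, hn, hn'⟩ := (h.and (key' φ.not (hcon.mono fun n hn => by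
    rwa [Language.Formula.realize_not]))).exists
  exact Language.Formula.realize_not.1 hn' hn

theorem IsPartialElementary.exists_insert' (hu : (u : Filter ℕ) ≤ atTop)
    (hS : IsPartialElementary L u v S) (hc : S.Countable) (hne : S.Nonempty) (y : ℕ → M) :
    ∃ x, IsPartialElementary L u v (insert (x, y) S) := by
  obtain ⟨x, hx⟩ := hS.swap.exists_insert hu (hc.image _) (hne.image _) y
  refine ⟨x, ?_⟩
  have := hx.swap
  rwa [image_insert_eq, image_image, Prod.swap_prod_mk, funext Prod.swap_swap, image_id'] at this

/-- If all sequences can be enumerated in type `ω₁`, then the ultrapowers are isomorphic. -/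
theorem exists_isPartialElementary_total (hu : (u : Filter ℕ) ≤ atTop)
    (hv : (v : Filter ℕ) ≤ atTop) {J : Type*} [LinearOrder J] [WellFoundedLT J]
    (hJ : ∀ j : J, (Iio j).Countable) (t : J → Bool × (ℕ → M)) (ht : t.Surjective) :
    ∃ S : Set ((ℕ → M) × (ℕ → M)), IsPartialElementary L u v S ∧
      (∀ x, ∃ y, (x, y) ∈ S) ∧ ∀ y, ∃ x, (x, y) ∈ S := by
  classical
  obtain ⟨c⟩ := ‹Nonempty M›
  have : Nonempty M := ⟨c⟩
  let p₀ : (ℕ → M) × (ℕ → M) := (fun _ => c, fun _ => c)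
  -- At stage `j` the sequence `(t j).2` is put into the domain or the range.
  let good : J → Set ((ℕ → M) × (ℕ → M)) → (ℕ → M) × (ℕ → M) → Prop := fun j S p =>
    IsPartialElementary L u v (insert p S) ∧ bif (t j).1 then p.1 = (t j).2 else p.2 = (t j).2
  have hgood : ∀ j S, IsPartialElementary L u v S → S.Countable → S.Nonempty →
      ∃ p, good j S p := by
    intro j S hS hc hne
    rcases hb : (t j).1 with _ | _
    · obtain ⟨x, hx⟩ := hS.exists_insert' hu hc hne (t j).2
      exact ⟨(x, (t j).2), hx, by simp [hb]⟩
    · obtain ⟨y, hy⟩ := hS.exists_insert hv hc hne (t j).2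
      exact ⟨((t j).2, y), hy, by simp [hb]⟩
  let z : J → (ℕ → M) × (ℕ → M) := WellFounded.fix (r := (· < ·)) wellFounded_lt fun j rec =>
    if h : ∃ p, good j (insert p₀ (range fun i : Iio j => rec i i.2)) p then h.choose else p₀
  have hz : ∀ j, (∃ p, good j (insert p₀ (z '' Iio j)) p) →
      good j (insert p₀ (z '' Iio j)) (z j) := by
    intro j h
    have h1 : z j = if h : ∃ p, good j (insert p₀ (range fun i : Iio j => z i)) p
        then h.choose else p₀ := WellFounded.fix_eq _ _ _
    rw [image_eq_range] at h ⊢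
    rw [h1, dif_pos h]
    exact h.choose_spec
  have hfin : ∀ I : Set J, (∀ i ∈ I, IsPartialElementary L u v (insert p₀ (z '' Iic i))) →
      IsPartialElementary L u v (insert p₀ (z '' I)) := by
    intro I hI
    refine isPartialElementary_of_finite (mem_insert p₀ _) fun T hT hTf _ => ?_
    have h1 : T \ {p₀} ⊆ z '' I := fun p hp => (hT hp.1).resolve_left hp.2
    have : Finite ↥(T \ {p₀}) := hTf.subset sdiff_subset
    choose g hgI hgz using fun p : ↥(T \ {p₀}) => h1 p.2
    rcases isEmpty_or_nonempty ↥(T \ {p₀}) with he | hne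
    · refine (isPartialElementary_singleton_const c).mono fun p hp => ?_
      by_contra hpc
      exact he.false ⟨p, hp, hpc⟩
    · obtain ⟨q, hq⟩ := Finite.exists_max g
      refine (hI (g q) (hgI q)).mono fun p hp => ?_
      by_cases hpc : p = p₀
      · exact Or.inl hpc
      · exact Or.inr ⟨g ⟨p, hp, hpc⟩, hq _, hgz _⟩
  have hall : ∀ j, IsPartialElementary L u v (insert p₀ (z '' Iic j)) ∧
      bif (t j).1 then (z j).1 = (t j).2 else (z j).2 = (t j).2 := by
    intro j
    induction j using WellFoundedLT.induction with
    | ind j ih =>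
      have h1 := hz j (hgood j _ (hfin (Iio j) fun i hi => (ih i hi).1)
        (((hJ j).image z).insert p₀) (insert_nonempty _ _))
      refine ⟨?_, h1.2⟩
      rw [← Iio_insert, image_insert_eq, insert_comm]
      exact h1.1
  refine ⟨insert p₀ (z '' univ), hfin univ fun i _ => (hall i).1, fun x => ?_, fun y => ?_⟩
  · obtain ⟨j, hj⟩ := ht (true, x)
    have := (hall j).2
    simp only [hj, cond_true] at this
    exact ⟨(z j).2, Or.inr ⟨j, trivial, by rw [← this]⟩⟩
  · obtain ⟨j, hj⟩ := ht (false, y)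
    have := (hall j).2
    simp only [hj, cond_false] at this
    exact ⟨(z j).1, Or.inr ⟨j, trivial, by rw [← this]⟩⟩

end BackAndForth

/-! ### Isomorphic fibers under the Continuum Hypothesis -/

section ContinuumHypothesis

open FirstOrder TopologicalSpace

/-- The relation symbols for closed sets: being empty, covering the space, and being
the intersection of two closed sets. -/
inductive ClosedSetRel : ℕ → Type
  | empty : ClosedSetRel 1
  | cover : ClosedSetRel 2
  | inter : ClosedSetRel 3

/-- The relational language of the relations `ClosedSetRel`. -/
def closedSetLanguage : Language where
  Functions _ := Empty
  Relations := ClosedSetRel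

instance : Countable closedSetLanguage.Symbols := by
  have h1 : Countable (Σ l, closedSetLanguage.Functions l) := by
    have : IsEmpty (Σ l, closedSetLanguage.Functions l) := ⟨fun x => x.2.elim⟩
    infer_instance
  have h2 : Countable (Σ l, closedSetLanguage.Relations l) := by
    refine Function.Injective.countable (f := Sigma.fst) ?_
    rintro ⟨_, r⟩ ⟨_, s⟩ h
    cases r <;> cases s <;> first | rfl | cases h
  exact inferInstanceAs (Countable (_ ⊕ _))

instance : closedSetLanguage.Structure (Closeds unitInterval) where
  funMap f := f.elim
  RelMap {_} r := match r with
    | .empty => fun a => a 0 = ⊥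
    | .cover => fun a => a 0 ⊔ a 1 = ⊤
    | .inter => fun a => a 2 = a 0 ⊓ a 1

theorem mk_closeds_le_continuum : Cardinal.mk (Closeds unitInterval) ≤ Cardinal.continuum := by
  obtain ⟨b, hb, -, hbasis⟩ := exists_countable_basis unitInterval
  have := hb.to_subtype
  have hinj : Function.Injective fun C : Closeds unitInterval =>
      {s : b | Disjoint s.1 (C : Set unitInterval)} := by
    have key : ∀ C D : Closeds unitInterval,
        {s : b | Disjoint s.1 (C : Set unitInterval)} ⊆
          {s : b | Disjoint s.1 (D : Set unitInterval)} → D ≤ C := by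
      intro C D h x hx
      by_contra hxC
      obtain ⟨s, hs, hxs, hsC⟩ := hbasis.exists_subset_of_mem_open
        (a := x) (u := (C : Set _)ᶜ) hxC C.isClosed.isOpen_compl
      have : (⟨s, hs⟩ : b) ∈ {s : b | Disjoint s.1 (C : Set unitInterval)} :=
        Set.disjoint_left.2 fun y hy => hsC hy
      exact Set.disjoint_left.1 (h this) hxs hx
    intro C D h
    exact le_antisymm (key D C (ge_of_eq h)) (key C D (le_of_eq h))
  refine (Cardinal.mk_le_of_injective hinj).trans ?_
  rw [Cardinal.mk_set]
  calc (2 : Cardinal) ^ Cardinal.mk b ≤ 2 ^ Cardinal.aleph0 :=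
        Cardinal.power_le_power_left two_ne_zero (Cardinal.mk_le_aleph0_iff.2 this)
    _ = Cardinal.continuum := Cardinal.two_power_aleph0

/-- The closed subset of `𝕄` with prescribed fibers. -/
def closedOfSeq (x : ℕ → Closeds unitInterval) : Set Mioid := {p | p.2 ∈ x p.1}

theorem isClosed_closedOfSeq (x : ℕ → Closeds unitInterval) : IsClosed (closedOfSeq x) :=
  isClosed_mioid_iff.2 fun n => (x n).isClosed

theorem exists_closedOfSeq_eq {C : Set Mioid} (hC : IsClosed C) : ∃ x, closedOfSeq x = C :=
  ⟨fun n => ⟨Prod.mk n ⁻¹' C, isClosed_mioid_iff.1 hC n⟩, rfl⟩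

theorem exists_total_of_continuumHypothesis (hCH : ContinuumHypothesis) {u v : Ultrafilter ℕ}
    (hu : (u : Filter ℕ) ≤ atTop) (hv : (v : Filter ℕ) ≤ atTop) :
    ∃ S : Set ((ℕ → Closeds unitInterval) × (ℕ → Closeds unitInterval)),
      IsPartialElementary closedSetLanguage u v S ∧
      (∀ x, ∃ y, (x, y) ∈ S) ∧ ∀ y, ∃ x, (x, y) ∈ S := by
  have hcard : Cardinal.mk (Bool × (ℕ → Closeds unitInterval)) ≤
      Cardinal.mk (Cardinal.aleph.{0} 1).ord.ToType := by
    rw [Cardinal.mk_ord_toType, ← (hCH : Cardinal.continuum.{0} = Cardinal.aleph 1)]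
    rw [Cardinal.mk_prod, Cardinal.lift_id, Cardinal.lift_id, ← Cardinal.power_def,
      Cardinal.mk_nat]
    calc _ ≤ Cardinal.continuum * Cardinal.continuum ^ Cardinal.aleph0 := by
          gcongr
          · rw [Cardinal.mk_bool]; exact_mod_cast (Cardinal.nat_lt_continuum 2).le
          · exact Cardinal.power_le_power_right mk_closeds_le_continuum
      _ = Cardinal.continuum := by simp
  obtain ⟨e⟩ := hcard
  refine exists_isPartialElementary_total hu hv (J := (Cardinal.aleph.{0} 1).ord.ToType)
    (fun j => ?_) (Function.invFun e) (Function.invFun_surjective e.injective)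
  have h1 := (Cardinal.mk_Iio_lt j (by simp)).trans_eq
    ((Cardinal.mk_ord_toType _).trans Cardinal.succ_aleph0.symm)
  exact Cardinal.le_aleph0_iff_set_countable.1 (Order.lt_succ_iff.1 h1)

/-- Under the Continuum Hypothesis the ultrapowers of the lattice of closed subsets of `[0,1]` are
isomorphic, and hence so are the continua of which they describe the closed sets. -/
theorem nonempty_homeomorph_of_continuumHypothesis (hCH : ContinuumHypothesis)
    {u v : Ultrafilter ℕ} (hu : (u : Filter ℕ) ≤ atTop) (hv : (v : Filter ℕ) ≤ atTop)
    {X Y : Type*} [TopologicalSpace X] [TopologicalSpace Y] [CompactSpace X] [CompactSpace Y]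
    {F : Set Mioid → Set X} {G : Set Mioid → Set Y}
    (hF : IsFiberLattice u F) (hG : IsFiberLattice v G) : Nonempty (X ≃ₜ Y) := by
  obtain ⟨S, hS, hx, hy⟩ := exists_total_of_continuumHypothesis hCH hu hv
  have hempty : ∀ p ∈ S, (∀ᶠ n in u, p.1 n = ⊥) ↔ ∀ᶠ n in v, p.2 n = ⊥ := fun p hp =>
    hS (fun _ => p) (fun _ => hp) (Language.Relations.formula
      (L := closedSetLanguage) ClosedSetRel.empty ![Language.Term.var 0])
  have hcover : ∀ p ∈ S, ∀ q ∈ S,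
      (∀ᶠ n in u, p.1 n ⊔ q.1 n = ⊤) ↔ ∀ᶠ n in v, p.2 n ⊔ q.2 n = ⊤ := fun p hp q hq =>
    hS (fun k => if k = 0 then p else q) (fun k => by split_ifs <;> assumption)
      (Language.Relations.formula (L := closedSetLanguage) ClosedSetRel.cover
        ![Language.Term.var 0, Language.Term.var 1])
  have hinter : ∀ p ∈ S, ∀ q ∈ S, ∀ r ∈ S,
      (∀ᶠ n in u, r.1 n = p.1 n ⊓ q.1 n) ↔ ∀ᶠ n in v, r.2 n = p.2 n ⊓ q.2 n :=
    fun p hp q hq r hr =>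
    hS (fun k => if k = 0 then p else if k = 1 then q else r)
      (fun k => by split_ifs <;> assumption)
      (Language.Relations.formula (L := closedSetLanguage) ClosedSetRel.inter
        ![Language.Term.var 0, Language.Term.var 1, Language.Term.var 2])
  have hbot : ∀ {w : Ultrafilter ℕ} (x : ℕ → Closeds unitInterval),
      (∀ᶠ n in w, Prod.mk n ⁻¹' closedOfSeq x = ∅) ↔ ∀ᶠ n in w, x n = ⊥ := fun x =>
    eventually_congr (Eventually.of_forall fun n => by
      rw [← Closeds.coe_eq_empty]; rfl)
  have htop : ∀ {w : Ultrafilter ℕ} (x y : ℕ → Closeds unitInterval),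
      (∀ᶠ n in w, Prod.mk n ⁻¹' (closedOfSeq x ∪ closedOfSeq y) = univ) ↔
        ∀ᶠ n in w, x n ⊔ y n = ⊤ := fun x y =>
    eventually_congr (Eventually.of_forall fun n => by
      rw [← Closeds.coe_eq_univ]; rfl)
  have hcovF : ∀ p q : S, F (closedOfSeq p.1.1) ∪ F (closedOfSeq q.1.1) = univ ↔
      ∀ᶠ n in u, p.1.1 n ⊔ q.1.1 n = ⊤ := fun p q => by
    rw [← hF.union, hF.eq_univ_iff ((isClosed_closedOfSeq _).union (isClosed_closedOfSeq _)), htop]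
  have hcovG : ∀ p q : S, G (closedOfSeq p.1.2) ∪ G (closedOfSeq q.1.2) = univ ↔
      ∀ᶠ n in v, p.1.2 n ⊔ q.1.2 n = ⊤ := fun p q => by
    rw [← hG.union, hG.eq_univ_iff ((isClosed_closedOfSeq _).union (isClosed_closedOfSeq _)), htop]
  have hcov : ∀ p q : S, F (closedOfSeq p.1.1) ∪ F (closedOfSeq q.1.1) = univ ↔
      G (closedOfSeq p.1.2) ∪ G (closedOfSeq q.1.2) = univ := fun p q => by
    rw [hcovF, hcovG, hcover p p.2 q q.2]
  refine nonempty_homeomorph_of_families (ι := S) (F := fun p => F (closedOfSeq p.1.1))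
    (G := fun p => G (closedOfSeq p.1.2)) (fun p => hF.isClosed _ (isClosed_closedOfSeq _))
    (fun p => hG.isClosed _ (isClosed_closedOfSeq _)) ?_ (fun p q => ?_) (fun p => ?_) hcov ?_ ?_
  · obtain ⟨y, hy⟩ := hx fun _ => ⊤
    have h1 := (hcovF ⟨_, hy⟩ ⟨_, hy⟩).2 (by simp)
    have h2 := (hcov _ _).1 h1
    rw [union_self] at h1 h2
    exact ⟨_, h1, h2⟩
  · obtain ⟨y, hy⟩ := hx fun n => p.1.1 n ⊓ q.1.1 n
    have h1 := (hinter p p.2 q q.2 _ hy).1 (by simp)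
    refine ⟨⟨_, hy⟩, ?_, ?_⟩
    · exact hF.inter _ _ (isClosed_closedOfSeq _) (isClosed_closedOfSeq _)
    · rw [← hG.inter _ _ (isClosed_closedOfSeq _) (isClosed_closedOfSeq _)]
      refine hG.eq_of_eventuallyEq (isClosed_closedOfSeq _)
        ((isClosed_closedOfSeq _).inter (isClosed_closedOfSeq _)) (h1.mono fun n hn => ?_)
      exact congrArg (fun C : Closeds unitInterval => (C : Set unitInterval)) hn
  · rw [hF.eq_empty_iff _ (isClosed_closedOfSeq _), hG.eq_empty_iff _ (isClosed_closedOfSeq _),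
      hbot, hbot, hempty p p.2]
  · intro p q hpq
    obtain ⟨C, D, hC, hD, h, hp, hq⟩ := hF.separates p q hpq
    obtain ⟨x, rfl⟩ := exists_closedOfSeq_eq hC
    obtain ⟨x', rfl⟩ := exists_closedOfSeq_eq hD
    obtain ⟨y, hxy⟩ := hx x
    obtain ⟨y', hxy'⟩ := hx x'
    exact ⟨⟨_, hxy⟩, ⟨_, hxy'⟩, hp, hq, by
      rw [← hF.union, h]; exact hF.eq_univ _ isClosed_univ (by simp)⟩
  · intro p q hpq
    obtain ⟨C, D, hC, hD, h, hp, hq⟩ := hG.separates p q hpq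
    obtain ⟨y, rfl⟩ := exists_closedOfSeq_eq hC
    obtain ⟨y', rfl⟩ := exists_closedOfSeq_eq hD
    obtain ⟨x, hxy⟩ := hy y
    obtain ⟨x', hxy'⟩ := hy y'
    exact ⟨⟨_, hxy⟩, ⟨_, hxy'⟩, hp, hq, by
      rw [← hG.union, h]; exact hG.eq_univ _ isClosed_univ (by simp)⟩

end ContinuumHypothesis

/-! ### Independent families of functions -/

section Conditions

variable {I : Type*}

/-- A finite set of pairs `(i, k)`, read as the condition `f i = k` for each of its members, is
functional if it prescribes at most one value for each `i`. -/
def IsFunctional (s : Finset (I × ℕ)) : Prop := ∀ p ∈ s, ∀ q ∈ s, p.1 = q.1 → p.2 = q.2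

/-- The set of coordinates at which the family `f` satisfies the condition `s`. -/
def cylinder (f : I → ℕ → ℕ) (s : Finset (I × ℕ)) : Set ℕ := {n | ∀ p ∈ s, f p.1 n = p.2}

theorem IsFunctional.mono {s t : Finset (I × ℕ)} (ht : IsFunctional t) (h : s ⊆ t) :
    IsFunctional s := fun p hp q hq => ht p (h hp) q (h hq)

theorem cylinder_anti {f : I → ℕ → ℕ} {s t : Finset (I × ℕ)} (h : s ⊆ t) :
    cylinder f t ⊆ cylinder f s := fun _ hn p hp => hn p (h hp)

theorem isFunctional_of_mem_cylinder {f : I → ℕ → ℕ} {s : Finset (I × ℕ)} {n : ℕ}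
    (hn : n ∈ cylinder f s) : IsFunctional s := fun p hp q hq h => by
  rw [← hn p hp, ← hn q hq, h]

/-- There are continuum many independent functions on a countable set: on pairs `(k, φ)` with
`φ : 2 ^ k → ω`, the function with index `x` takes the value `φ (x ↾ k)`. -/
theorem exists_independent_functions : ∃ f : (ℕ → Bool) → ℕ → ℕ,
    ∀ s : Finset ((ℕ → Bool) × ℕ), IsFunctional s → (cylinder f s).Nonempty := by
  classical
  obtain ⟨e, he⟩ := exists_surjective_nat (Σ k : ℕ, ((Fin k → Bool) → ℕ))
  refine ⟨fun x n => (e n).2 fun i => x i, fun s hs => ?_⟩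
  have hd : ∀ x y : ℕ → Bool, ∃ d, x ≠ y → x d ≠ y d := fun x y => by
    by_cases h : x = y
    · exact ⟨0, fun h' => absurd h h'⟩
    · obtain ⟨d, hd⟩ := Function.ne_iff.1 h
      exact ⟨d, fun _ => hd⟩
  choose d hd using hd
  let k := (s ×ˢ s).sup (fun p => d p.1.1 p.2.1) + 1
  let φ : (Fin k → Bool) → ℕ := fun z =>
    if h : ∃ p ∈ s, (fun i : Fin k => p.1 i) = z then h.choose.2 else 0
  obtain ⟨n, hn⟩ := he ⟨k, φ⟩
  refine ⟨n, fun p hp => ?_⟩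
  have h : ∃ q ∈ s, (fun i : Fin k => q.1 i) = fun i : Fin k => p.1 i := ⟨p, hp, rfl⟩
  have h1 : φ (fun i : Fin k => p.1 i) = p.2 := by
    simp only [φ]
    rw [dif_pos h]
    obtain ⟨hq, hqe⟩ := h.choose_spec
    refine hs _ hq _ hp ?_
    by_contra hne
    have hlt : d h.choose.1 p.1 < k := Nat.lt_succ_of_le
      (Finset.le_sup (f := fun p : ((ℕ → Bool) × ℕ) × ((ℕ → Bool) × ℕ) => d p.1.1 p.2.1)
        (Finset.mk_mem_product hq hp))
    exact hd _ _ hne (congrFun hqe ⟨_, hlt⟩)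
  change (e n).2 (fun i => p.1 i) = p.2
  rw [hn]
  exact h1

/-- The family `f` is independent modulo `D`: all its conditions are `D`-positive. -/
def IsIndependentMod (f : I → ℕ → ℕ) (D : Filter ℕ) : Prop :=
  ∀ s, IsFunctional s → ∃ᶠ n in D, n ∈ cylinder f s

theorem exists_maximal_filter {f : I → ℕ → ℕ}
    (hf : ∀ s, IsFunctional s → (cylinder f s).Nonempty) :
    ∃ D, IsIndependentMod f D ∧ ∀ D' ≤ D, IsIndependentMod f D' → D' = D := by
  have := zorn_le₀ (α := (Filter ℕ)ᵒᵈ) {D | IsIndependentMod f (OrderDual.ofDual D)} ?_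
  · obtain ⟨D, hD, hmax⟩ := this
    exact ⟨OrderDual.ofDual D, hD, fun D' hle hD' => le_antisymm hle (hmax hD' hle)⟩
  · intro c hc hchain
    rcases c.eq_empty_or_nonempty with rfl | hne
    · refine ⟨OrderDual.toDual ⊤, fun s hs => ?_, by simp⟩
      exact frequently_top.2 (hf s hs)
    · have := hne.to_subtype
      refine ⟨OrderDual.toDual (⨅ D : c, OrderDual.ofDual D.1), fun s hs => ?_, fun D hD => ?_⟩
      · have hdir : Directed (· ≥ ·) fun D : c => OrderDual.ofDual D.1 := by
          rintro ⟨D, hD⟩ ⟨E, hE⟩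
          rcases hchain.total hD hE with h | h
          · exact ⟨⟨E, hE⟩, h, le_rfl⟩
          · exact ⟨⟨D, hD⟩, le_rfl, h⟩
        intro hcon
        obtain ⟨D, hD⟩ := (mem_iInf_of_directed hdir _).1 hcon
        exact hc D.2 s hs hD
      · exact iInf_le (fun D : c => OrderDual.ofDual D.1) ⟨D, hD⟩

/-- The condition `s` forces membership in `X`, modulo `D`. -/
def Forces (f : I → ℕ → ℕ) (D : Filter ℕ) (s : Finset (I × ℕ)) (X : Set ℕ) : Prop :=
  ∀ᶠ n in D, n ∈ cylinder f s → n ∈ X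

variable {f : I → ℕ → ℕ} {D : Filter ℕ}

theorem Forces.mono {s t : Finset (I × ℕ)} {X : Set ℕ} (hs : Forces f D s X) (h : s ⊆ t) :
    Forces f D t X := Eventually.mono hs fun _ hn ht => hn (cylinder_anti h ht)

theorem Forces.false (hD : IsIndependentMod f D) {s t : Finset (I × ℕ)} {X : Set ℕ}
    (hs : Forces f D s X) (ht : Forces f D t Xᶜ) {r : Finset (I × ℕ)} (hr : IsFunctional r)
    (hsr : s ⊆ r) (htr : t ⊆ r) : False := by
  obtain ⟨n, hn, h1, h2⟩ := ((hD r hr).and_eventually (hs.and ht)).exists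
  exact h2 (cylinder_anti htr hn) (h1 (cylinder_anti hsr hn))

section Maximal

variable (hD : IsIndependentMod f D) (hmax : ∀ D' ≤ D, IsIndependentMod f D' → D' = D)
include hD hmax

omit hD in
/-- Maximality of the filter makes the conditions dense among the positive sets. -/
theorem exists_forces {X : Set ℕ} (hX : ∃ᶠ n in D, n ∈ X) :
    ∃ s, IsFunctional s ∧ Forces f D s X := by
  by_contra! hcon
  have h1 : IsIndependentMod f (D ⊓ 𝓟 Xᶜ) := fun s hs => by
    intro h
    rw [eventually_inf_principal] at h
    exact hcon s hs (h.mono fun n hn hns => by by_contra hnX; exact hn hnX hns)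
  have h2 : Xᶜ ∈ D := by
    rw [← hmax _ inf_le_left h1]
    exact mem_inf_of_right (mem_principal_self _)
  exact hX h2

theorem exists_forces_superset [DecidableEq I] {s : Finset (I × ℕ)} {X : Set ℕ}
    (h : ∃ᶠ n in D, n ∈ cylinder f s ∩ X) :
    ∃ t, s ⊆ t ∧ IsFunctional t ∧ Forces f D t X := by
  obtain ⟨t, ht, htX⟩ := exists_forces hmax h
  obtain ⟨n, hn, hn'⟩ := ((hD t ht).and_eventually htX).exists
  refine ⟨s ∪ t, Finset.subset_union_left, isFunctional_of_mem_cylinder (f := f) (n := n) ?_,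
    Forces.mono (Eventually.mono htX fun n h h' => (h h').2) Finset.subset_union_right⟩
  intro p hp
  rcases Finset.mem_union.1 hp with hp | hp
  · exact (hn' hn).1 p hp
  · exact hn p hp

theorem exists_decides [DecidableEq I] {s : Finset (I × ℕ)} (hs : IsFunctional s) (X : Set ℕ) :
    ∃ t, s ⊆ t ∧ IsFunctional t ∧ (Forces f D t X ∨ Forces f D t Xᶜ) := by
  have h : (∃ᶠ n in D, n ∈ cylinder f s ∩ X) ∨ ∃ᶠ n in D, n ∈ cylinder f s ∩ Xᶜ := by
    rw [← frequently_or_distrib]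
    refine (hD s hs).mono fun n hn => ?_
    by_cases hX : n ∈ X
    · exact Or.inl ⟨hn, hX⟩
    · exact Or.inr ⟨hn, hX⟩
  rcases h with h | h
  · obtain ⟨t, h1, h2, h3⟩ := exists_forces_superset hD hmax h
    exact ⟨t, h1, h2, Or.inl h3⟩
  · obtain ⟨t, h1, h2, h3⟩ := exists_forces_superset hD hmax h
    exact ⟨t, h1, h2, Or.inr h3⟩

end Maximal

/-! ### Sets determined by part of an independent family -/

open scoped Classical in
/-- The part of a condition that concerns the indices in `J`. -/
noncomputable def restr (J : Set I) (s : Finset (I × ℕ)) : Finset (I × ℕ) :=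
  s.filter fun p => p.1 ∈ J

theorem mem_restr {J : Set I} {s : Finset (I × ℕ)} {p : I × ℕ} :
    p ∈ restr J s ↔ p ∈ s ∧ p.1 ∈ J := by
  classical
  simp [restr]

theorem restr_subset {J : Set I} {s : Finset (I × ℕ)} : restr J s ⊆ s :=
  fun _ hp => (mem_restr.1 hp).1

variable (f D) in
/-- `X` is determined by the functions `f i`, `i ∈ J`, modulo `D`: conditions that force different
answers to `n ∈ X` are already incompatible when restricted to `J`. For a maximal `D`
this means that `X` belongs to the completion, in `P(ω)/D`, of the subalgebra generated by these
functions. -/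
def Determined (J : Set I) (X : Set ℕ) : Prop :=
  ∀ s t, IsFunctional s → IsFunctional t → Forces f D s X → Forces f D t Xᶜ →
    ∃ p ∈ s, ∃ q ∈ t, p.1 ∈ J ∧ p.1 = q.1 ∧ p.2 ≠ q.2

theorem isFunctional_union [DecidableEq I] {J : Set I} {a t : Finset (I × ℕ)}
    (ha : IsFunctional a) (ht : IsFunctional t) (haJ : ∀ p ∈ a, p.1 ∈ J) (hta : restr J t ⊆ a) :
    IsFunctional (t ∪ a) := by
  intro p hp q hq h
  rcases Finset.mem_union.1 hp with hp | hp <;> rcases Finset.mem_union.1 hq with hq | hq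
  · exact ht p hp q hq h
  · exact ha p (hta (mem_restr.2 ⟨hp, h ▸ haJ q hq⟩)) q hq h
  · exact ha p hp q (hta (mem_restr.2 ⟨hq, h ▸ haJ p hp⟩)) h
  · exact ha p hp q hq h

/-- Compatibility over `J` in the sense of `Determined` means that the restrictions to `J` have a
common extension. -/
theorem isFunctional_restr_union [DecidableEq I] {J : Set I} {s t : Finset (I × ℕ)}
    (hs : IsFunctional s) (ht : IsFunctional t)
    (h : ¬ ∃ p ∈ s, ∃ q ∈ t, p.1 ∈ J ∧ p.1 = q.1 ∧ p.2 ≠ q.2) :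
    IsFunctional (restr J s ∪ restr J t) := by
  push Not at h
  intro p hp q hq hpq
  simp only [Finset.mem_union, mem_restr] at hp hq
  rcases hp with ⟨hp, hpJ⟩ | ⟨hp, hpJ⟩ <;> rcases hq with ⟨hq, hqJ⟩ | ⟨hq, hqJ⟩
  · exact hs p hp q hq hpq
  · exact h p hp q hq hpJ hpq
  · exact (h q hq p hp hqJ hpq.symm).symm
  · exact ht p hp q hq hpq

theorem Determined.mono {J K : Set I} {X : Set ℕ} (hX : Determined f D J X) (h : J ⊆ K) :
    Determined f D K X := fun s t hs ht hsX htX => by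
  obtain ⟨p, hp, q, hq, hJ, hpq⟩ := hX s t hs ht hsX htX
  exact ⟨p, hp, q, hq, h hJ, hpq⟩

theorem Determined.compl {J : Set I} {X : Set ℕ} (hX : Determined f D J X) :
    Determined f D J Xᶜ := fun s t hs ht hsX htX => by
  rw [compl_compl] at htX
  obtain ⟨p, hp, q, hq, hJ, hpq, hne⟩ := hX t s ht hs htX hsX
  exact ⟨q, hq, p, hp, hpq ▸ hJ, hpq.symm, hne.symm⟩

theorem determined_univ (hD : IsIndependentMod f D) (J : Set I) : Determined f D J univ :=
  fun _ t _ ht _ htX =>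
    (Forces.false hD (s := t) (X := univ) (Eventually.of_forall fun _ _ => trivial) htX ht
      Subset.rfl Subset.rfl).elim

theorem determined_const (hD : IsIndependentMod f D) (J : Set I) (p : Prop) :
    Determined f D J {_n | p} := by
  by_cases hp : p
  · simpa [hp] using determined_univ hD J
  · simpa [hp] using (determined_univ hD J).compl

section Maximal

variable (hD : IsIndependentMod f D) (hmax : ∀ D' ≤ D, IsIndependentMod f D' → D' = D)
include hD hmax

theorem Determined.inter {J : Set I} {X Y : Set ℕ} (hX : Determined f D J X)
    (hY : Determined f D J Y) : Determined f D J (X ∩ Y) := by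
  classical
  intro s t hs ht hsXY htXY
  by_contra hcon
  have hc := isFunctional_restr_union hs ht hcon
  have hr : IsFunctional (t ∪ (restr J s ∪ restr J t)) := isFunctional_union hc ht
    (by simp only [Finset.mem_union, mem_restr]; tauto) Finset.subset_union_right
  have hfreq : (∃ᶠ n in D, n ∈ cylinder f (t ∪ (restr J s ∪ restr J t)) ∩ Xᶜ) ∨
      ∃ᶠ n in D, n ∈ cylinder f (t ∪ (restr J s ∪ restr J t)) ∩ Yᶜ := by
    rw [← frequently_or_distrib]
    refine ((hD _ hr).and_eventually htXY).mono fun n hn => ?_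
    have := hn.2 (cylinder_anti Finset.subset_union_left hn.1)
    rw [compl_inter] at this
    exact this.imp (fun h => ⟨hn.1, h⟩) fun h => ⟨hn.1, h⟩
  -- An extension of `t` and of `s` restricted to `J` agrees with `s` on `J`.
  have key : ∀ t', t ∪ (restr J s ∪ restr J t) ⊆ t' → IsFunctional t' →
      ¬ ∃ p ∈ s, ∃ q ∈ t', p.1 ∈ J ∧ p.1 = q.1 ∧ p.2 ≠ q.2 := by
    rintro t' ht't ht' ⟨p, hp, q, hq, hJ, hpq, hne⟩
    exact hne (ht' p (ht't (by simp [mem_restr, hp, hJ])) q hq hpq)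
  rcases hfreq with h | h
  · obtain ⟨t', h1, h2, h3⟩ := exists_forces_superset hD hmax h
    exact key t' h1 h2 (hX s t' hs h2 (Eventually.mono hsXY fun _ h h' => (h h').1) h3)
  · obtain ⟨t', h1, h2, h3⟩ := exists_forces_superset hD hmax h
    exact key t' h1 h2 (hY s t' hs h2 (Eventually.mono hsXY fun _ h h' => (h h').2) h3)

omit hD hmax in
theorem determined_le {J : Set I} {i : I} {g : ℕ → ℕ∞}
    (hg : ∀ m : ℕ, Determined f D J {n | (m : ℕ∞) ≤ g n}) :
    Determined f D (insert i J) {n | (f i n : ℕ∞) ≤ g n} := by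
  classical
  intro s t hs ht hsX htX
  by_contra hcon
  have hc := isFunctional_restr_union hs ht hcon
  have hJ' : ∀ p ∈ restr (insert i J) s ∪ restr (insert i J) t, p.1 ∈ insert i J := by
    intro p hp
    rcases Finset.mem_union.1 hp with hp | hp <;> exact (mem_restr.1 hp).2
  -- Extend the common part by a value `m` at `i`.
  obtain ⟨a, m, ha, haJ, hra, him⟩ : ∃ a : Finset (I × ℕ), ∃ m, IsFunctional a ∧
      (∀ p ∈ a, p.1 ∈ insert i J) ∧
      restr (insert i J) s ∪ restr (insert i J) t ⊆ a ∧ (i, m) ∈ a := by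
    by_cases h : ∃ p ∈ restr (insert i J) s ∪ restr (insert i J) t, p.1 = i
    · obtain ⟨⟨j, m⟩, hp, rfl⟩ := h
      exact ⟨_, m, hc, hJ', Subset.rfl, hp⟩
    · push Not at h
      refine ⟨insert (i, 0) (restr (insert i J) s ∪ restr (insert i J) t), 0, ?_, ?_,
        Finset.subset_insert _ _, Finset.mem_insert_self _ _⟩
      · intro p hp q hq hpq
        rcases Finset.mem_insert.1 hp with rfl | hp <;> rcases Finset.mem_insert.1 hq with rfl | hq
        · rfl
        · exact absurd hpq.symm (h q hq)
        · exact absurd hpq (h p hp)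
        · exact hc p hp q hq hpq
      · intro p hp
        rcases Finset.mem_insert.1 hp with rfl | hp
        · exact mem_insert _ _
        · exact hJ' p hp
  have hs' := isFunctional_union ha hs haJ (Finset.union_subset_left hra)
  have ht' := isFunctional_union ha ht haJ (Finset.union_subset_right hra)
  have hval : ∀ r n, n ∈ cylinder f (r ∪ a) → f i n = m := fun r n hn =>
    hn (i, m) (Finset.mem_union_right _ him)
  obtain ⟨p, hp, q, hq, hpJ, hpq, hne⟩ := hg m (s ∪ a) (t ∪ a) hs' ht'
    (Eventually.mono hsX fun n hn hns => by
      have h1 := hn (cylinder_anti Finset.subset_union_left hns)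
      rwa [mem_ofPred_eq, hval _ _ hns] at h1)
    (Eventually.mono htX fun n hn hns => by
      have h1 := hn (cylinder_anti Finset.subset_union_left hns)
      rwa [mem_compl_iff, mem_ofPred_eq, hval _ _ hns] at h1)
  have hpa : p ∈ a := by
    rcases Finset.mem_union.1 hp with hp | hp
    · exact hra (Finset.mem_union_left _ (mem_restr.2 ⟨hp, Or.inr hpJ⟩))
    · exact hp
  have hqa : q ∈ a := by
    rcases Finset.mem_union.1 hq with hq | hq
    · exact hra (Finset.mem_union_right _ (mem_restr.2 ⟨hq, Or.inr (hpq ▸ hpJ)⟩))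
    · exact hq
  exact hne (ha p hpa q hqa hpq)

omit hD in
/-- A function outside the determining part may still take any value on a positive set. -/
theorem Determined.frequently_and_eq {J : Set I} {X : Set ℕ} (hX : Determined f D J X)
    (hpos : ∃ᶠ n in D, n ∈ X) {i : I} (hi : i ∉ J) (k : ℕ) :
    ∃ᶠ n in D, n ∈ X ∧ f i n = k := by
  classical
  intro hcon
  obtain ⟨s, hs, hsX⟩ := exists_forces hmax hpos
  have hr : IsFunctional (insert (i, k) (restr J s)) := by
    have hJ : ∀ p ∈ restr J s, p.1 ≠ i := fun p hp h => hi (h ▸ (mem_restr.1 hp).2)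
    intro p hp q hq hpq
    rcases Finset.mem_insert.1 hp with rfl | hp <;> rcases Finset.mem_insert.1 hq with rfl | hq
    · rfl
    · exact absurd hpq.symm (hJ q hq)
    · exact absurd hpq (hJ p hp)
    · exact hs p (restr_subset hp) q (restr_subset hq) hpq
  obtain ⟨p, hp, q, hq, hpJ, hpq, hne⟩ := hX s _ hs hr hsX
    (Eventually.mono hcon fun n hn hns hnX => hn ⟨hnX, hns (i, k) (Finset.mem_insert_self _ _)⟩)
  rcases Finset.mem_insert.1 hq with rfl | hq
  · have hpi : p.1 = i := hpq
    exact hi (hpi ▸ hpJ)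
  · exact hne (hs p hp q (restr_subset hq) hpq)

omit hmax in
/-- If every condition over `J` has an extension over `J` that decides `X`, then `X` is
determined by `J`. -/
theorem determined_of_decides {J : Set I} {X : Set ℕ}
    (h : ∀ s, IsFunctional s → (∀ p ∈ s, p.1 ∈ J) → ∃ t, s ⊆ t ∧ IsFunctional t ∧
      (∀ p ∈ t, p.1 ∈ J) ∧ (Forces f D t X ∨ Forces f D t Xᶜ)) : Determined f D J X := by
  classical
  intro s t hs ht hsX htX
  by_contra hcon
  obtain ⟨r, h1, h2, h3, h4⟩ := h _ (isFunctional_restr_union hs ht hcon)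
    (by simp only [Finset.mem_union, mem_restr]; tauto)
  rcases h4 with h4 | h4
  · exact Forces.false hD h4 htX
      (isFunctional_union h2 ht h3 (Finset.union_subset_right h1))
      Finset.subset_union_right Finset.subset_union_left
  · exact Forces.false hD hsX h4
      (isFunctional_union h2 hs h3 (Finset.union_subset_left h1))
      Finset.subset_union_left Finset.subset_union_right

end Maximal

end Conditions

/-! ### Ultrafilters with prescribed coinitiality of the infinite part -/

section Construction

variable {I : Type*} {f : I → ℕ → ℕ} {D : Filter ℕ}

section Step

variable [Preorder I]

variable (f D) in
/-- The data of the requirements imposed on `f i`: a set `X` and a function `g` (which may take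
the value `⊤`) determined by the earlier functions, where `X` belongs to `w` and
`g` is infinite modulo `w`, and a lower bound `k`. -/
def requirements (i : I) (w : Ultrafilter ℕ) : Set (Set ℕ × ℕ × (ℕ → ℕ∞)) :=
  {x | x.1 ∈ w ∧ Determined f D (Iio i) x.1 ∧
    (∀ m : ℕ, Determined f D (Iio i) {n | (m : ℕ∞) ≤ x.2.2 n}) ∧
    ∀ m : ℕ, {n | (m : ℕ∞) ≤ x.2.2 n} ∈ w}

/-- The set on which `f i` is larger than the given number but bounded by the given function. -/
def requirementSet (f : I → ℕ → ℕ) (i : I) (x : Set ℕ × ℕ × (ℕ → ℕ∞)) : Set ℕ :=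
  x.1 ∩ ({n | x.2.1 < f i n} ∩ {n | (f i n : ℕ∞) ≤ x.2.2 n})

variable (f D) in
/-- The filter generated by `D`, by the members of `w` that are determined by the functions before
`f i`, and by the requirements that `f i` be infinite and lie below all earlier infinite
functions. -/
def stepFilter (i : I) (w : Ultrafilter ℕ) : Filter ℕ :=
  ⨅ x : requirements f D i w, D ⊓ 𝓟 (requirementSet f i x)

theorem top_mem_requirements (hD : IsIndependentMod f D) {i : I} {w : Ultrafilter ℕ} {X : Set ℕ}
    (hX : X ∈ w) (hd : Determined f D (Iio i) X) (k : ℕ) :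
    (X, k, fun _ => ⊤) ∈ requirements f D i w :=
  ⟨hX, hd, fun m => by simpa using determined_univ hD _, fun m => by
    simp only [le_top]; exact univ_mem⟩

theorem stepFilter_le (hD : IsIndependentMod f D) (i : I) (w : Ultrafilter ℕ) :
    stepFilter f D i w ≤ D :=
  (iInf_le _ ⟨_, top_mem_requirements hD univ_mem (determined_univ hD _) 0⟩).trans inf_le_left

theorem requirementSet_mem_stepFilter {i : I} {w : Ultrafilter ℕ} {x : Set ℕ × ℕ × (ℕ → ℕ∞)}
    (hx : x ∈ requirements f D i w) : requirementSet f i x ∈ stepFilter f D i w :=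
  iInf_le (fun x : requirements f D i w => D ⊓ 𝓟 (requirementSet f i x)) ⟨x, hx⟩
    (mem_inf_of_right (mem_principal_self _))

theorem mem_stepFilter (hD : IsIndependentMod f D) {i : I} {w : Ultrafilter ℕ} {X : Set ℕ}
    (hX : X ∈ w) (hd : Determined f D (Iio i) X) : X ∈ stepFilter f D i w :=
  mem_of_superset (requirementSet_mem_stepFilter (top_mem_requirements hD hX hd 0))
    inter_subset_left

theorem lt_mem_stepFilter (hD : IsIndependentMod f D) (i : I) (w : Ultrafilter ℕ) (k : ℕ) :
    {n | k < f i n} ∈ stepFilter f D i w :=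
  mem_of_superset (requirementSet_mem_stepFilter
    (top_mem_requirements hD univ_mem (determined_univ hD _) k)) fun _ hn => hn.2.1

theorem le_mem_stepFilter (hD : IsIndependentMod f D) {i : I} {w : Ultrafilter ℕ} {g : ℕ → ℕ∞}
    (hd : ∀ m : ℕ, Determined f D (Iio i) {n | (m : ℕ∞) ≤ g n})
    (hg : ∀ m : ℕ, {n | (m : ℕ∞) ≤ g n} ∈ w) :
    {n | (f i n : ℕ∞) ≤ g n} ∈ stepFilter f D i w :=
  mem_of_superset (requirementSet_mem_stepFilter (x := (univ, 0, g))
    ⟨univ_mem, determined_univ hD _, hd, hg⟩) fun _ hn => hn.2.2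

variable (hD : IsIndependentMod f D) (hmax : ∀ D' ≤ D, IsIndependentMod f D' → D' = D)
include hD hmax

theorem neBot_stepFilter {i : I} {w : Ultrafilter ℕ} (hw : (w : Filter ℕ) ≤ D) :
    (stepFilter f D i w).NeBot := by
  refine iInf_neBot_of_directed ?_ fun x => ?_
  · rintro ⟨⟨X, k, g⟩, hX, hXd, hgd, hg⟩ ⟨⟨Y, l, h⟩, hY, hYd, hhd, hh⟩
    refine ⟨⟨(X ∩ Y, max k l, fun n => min (g n) (h n)), inter_mem hX hY,
      hXd.inter hD hmax hYd, fun m => ?_, fun m => ?_⟩, ?_, ?_⟩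
    · simp only [le_min_iff]
      exact (hgd m).inter hD hmax (hhd m)
    · simp only [le_min_iff]
      exact inter_mem (hg m) (hh m)
    · refine inf_le_inf_left _ (principal_mono.2 ?_)
      rintro n ⟨h1, h2, h3⟩
      simp only [mem_ofPred_eq, max_lt_iff, le_min_iff] at h2 h3
      exact ⟨h1.1, h2.1, h3.1⟩
    · refine inf_le_inf_left _ (principal_mono.2 ?_)
      rintro n ⟨h1, h2, h3⟩
      simp only [mem_ofPred_eq, max_lt_iff, le_min_iff] at h2 h3
      exact ⟨h1.2, h2.2, h3.2⟩
  · obtain ⟨⟨X, k, g⟩, hX, hXd, hgd, hg⟩ := x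
    refine frequently_mem_iff_neBot.1 ?_
    -- On a positive set `X` holds and `g` exceeds `k + 1`; there `f i` may take the value `k + 1`.
    have h1 : ∃ᶠ n in D, n ∈ X ∩ {n | ((k + 1 : ℕ) : ℕ∞) ≤ g n} := by
      have : ∃ᶠ n in (w : Filter ℕ), n ∈ X ∩ {n | ((k + 1 : ℕ) : ℕ∞) ≤ g n} :=
        Eventually.frequently (inter_mem hX (hg (k + 1)))
      exact this.filter_mono hw
    refine ((hXd.inter hD hmax (hgd (k + 1))).frequently_and_eq hmax h1 (i := i)
      (by simp) (k + 1)).mono ?_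
    rintro n ⟨⟨h1, h2⟩, h3⟩
    refine ⟨h1, ?_, ?_⟩
    · change k < f i n
      omega
    · change (f i n : ℕ∞) ≤ g n
      rw [h3]
      exact h2

theorem stepFilter_mono {i j : I} (hij : i < j) {w w' : Ultrafilter ℕ}
    (h : (w' : Filter ℕ) ≤ stepFilter f D i w) : stepFilter f D j w' ≤ stepFilter f D i w := by
  refine le_iInf fun x => le_inf (stepFilter_le hD j w') (le_principal_iff.2 ?_)
  obtain ⟨⟨X, k, g⟩, hX⟩ := x
  have hsub : insert i (Iio i) ⊆ Iio j := by
    rintro a (rfl | ha)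
    · exact hij
    · exact lt_trans ha hij
  refine mem_stepFilter hD (h (requirementSet_mem_stepFilter hX)) ?_
  refine (hX.2.1.mono fun a ha => lt_trans ha hij).inter hD hmax (Determined.inter hD hmax ?_ ?_)
  · have h1 : {n | k < f i n} = {n | (f i n : ℕ∞) ≤ (k : ℕ∞)}ᶜ := by
      ext n; simp
    change Determined f D (Iio j) {n | k < f i n}
    rw [h1]
    exact ((determined_le (J := Iio i) (g := fun _ => (k : ℕ∞))
      fun m => determined_const hD _ _).mono hsub).compl
  · exact (determined_le hX.2.2.1).mono hsub

end Step

variable [LinearOrder I] [WellFoundedLT I]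

/-- If every countable family of sets is determined by an initial segment of the family `f`, then
some ultrafilter makes the values of `f` coinitial among its infinite functions. -/
theorem exists_ultrafilter_of_determined (hD : IsIndependentMod f D)
    (hmax : ∀ D' ≤ D, IsIndependentMod f D' → D' = D)
    (hdet : ∀ X : ℕ → Set ℕ, ∃ i : I, ∀ m, Determined f D (Iio i) (X m)) :
    ∃ u : Ultrafilter ℕ, (∀ i k, ∀ᶠ n in u, k < f i n) ∧
      (∀ i j, i < j → ∀ᶠ n in u, f j n ≤ f i n) ∧
      ∀ g : ℕ → ℕ, (∀ m, ∀ᶠ n in u, m ≤ g n) → ∃ i, ∀ᶠ n in u, f i n ≤ g n := by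
  classical
  -- Choose recursively an ultrafilter below the filters of all earlier steps.
  let pick : Filter ℕ → Ultrafilter ℕ := fun F =>
    if h : F.NeBot then @Ultrafilter.of _ F h else pure 0
  have hpick : ∀ F : Filter ℕ, F.NeBot → (pick F : Filter ℕ) ≤ F := by
    intro F h
    simp only [pick, dif_pos h]
    exact @Ultrafilter.of_le _ F h
  let w : I → Ultrafilter ℕ := WellFounded.fix (r := (· < ·)) wellFounded_lt fun i rec =>
    pick (D ⊓ ⨅ j : Iio i, stepFilter f D j (rec j j.2))
  have hw : ∀ i, w i = pick (D ⊓ ⨅ j : Iio i, stepFilter f D j (w j)) := fun i =>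
    WellFounded.fix_eq _ _ _
  have hDne : D.NeBot := by
    refine neBot_iff.2 ?_
    rintro rfl
    exact hD ∅ (by intro p hp; simp at hp) (by simp)
  have hne : ∀ A : Set I, (∀ i ∈ A, (w i : Filter ℕ) ≤
      D ⊓ ⨅ j : Iio i, stepFilter f D j (w j)) →
      (D ⊓ ⨅ j : A, stepFilter f D j (w j)).NeBot := by
    intro A hA
    rcases isEmpty_or_nonempty A with he | hne
    · simpa using hDne
    · rw [inf_iInf]
      refine iInf_neBot_of_directed ?_ fun i => ?_
      · have key : ∀ i j : A, i ≤ j →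
            D ⊓ stepFilter f D j (w j) ≤ D ⊓ stepFilter f D i (w i) := by
          intro i j hij
          rcases hij.eq_or_lt with rfl | hlt
          · exact le_rfl
          · refine inf_le_inf_left _ (stepFilter_mono hD hmax hlt ?_)
            exact (hA j j.2).trans (inf_le_right.trans
              (iInf_le (fun k : Iio j.1 => stepFilter f D k (w k)) ⟨i.1, hlt⟩))
        intro i j
        rcases le_total i j with h | h
        · exact ⟨j, key i j h, le_rfl⟩
        · exact ⟨i, le_rfl, key j i h⟩
      · rw [inf_eq_right.2 (stepFilter_le hD _ _)]
        exact neBot_stepFilter hD hmax ((hA i i.2).trans inf_le_left)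
  have hwle : ∀ i, (w i : Filter ℕ) ≤ D ⊓ ⨅ j : Iio i, stepFilter f D j (w j) := by
    intro i
    induction i using WellFoundedLT.induction with
    | ind i ih =>
      conv_lhs => rw [hw i]
      exact hpick _ (hne (Iio i) fun j hj => ih j hj)
  have hun := hne univ fun i _ => hwle i
  set u := pick (D ⊓ ⨅ j : (univ : Set I), stepFilter f D j (w j)) with hu
  have hule : ∀ i, (u : Filter ℕ) ≤ stepFilter f D i (w i) := fun i =>
    (hpick _ hun).trans (inf_le_right.trans
      (iInf_le (fun j : (univ : Set I) => stepFilter f D j (w j)) ⟨i, trivial⟩))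
  -- The ultrafilter `u` agrees with `w i` on the sets determined by the functions before `f i`.
  have hmem : ∀ i X, Determined f D (Iio i) X → X ∈ u → X ∈ w i := by
    intro i X hX hXu
    by_contra h
    rw [← Ultrafilter.compl_mem_iff_notMem] at h
    exact Ultrafilter.compl_mem_iff_notMem.1 (hule i (mem_stepFilter hD h hX.compl)) hXu
  have hlt : ∀ i k, ∀ᶠ n in u, k < f i n := fun i k => hule i (lt_mem_stepFilter hD i _ k)
  have hle : ∀ i, ∀ g : ℕ → ℕ, (∀ m, Determined f D (Iio i) {n | m ≤ g n}) →
      (∀ m, ∀ᶠ n in u, m ≤ g n) → ∀ᶠ n in u, f i n ≤ g n := by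
    intro i g hg hgu
    have := hule i (le_mem_stepFilter hD (g := fun n => (g n : ℕ∞)) (by simpa using hg)
      fun m => hmem i _ (by simpa using hg m) (by simp only [Nat.cast_le]; exact hgu m))
    simp only [Nat.cast_le] at this
    exact this
  refine ⟨u, hlt, fun i j hij => hle j (f i) (fun m => ?_) fun m => (hlt i m).mono fun n h => h.le,
    fun g hg => ?_⟩
  · rcases m with _ | m
    · simpa using determined_univ hD _
    · have h1 : {n | m + 1 ≤ f i n} = {n | (f i n : ℕ∞) ≤ (m : ℕ∞)}ᶜ := by
        ext n; simp
      rw [h1]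
      refine ((determined_le (J := Iio i) (g := fun _ => (m : ℕ∞))
        fun m => determined_const hD _ _).mono ?_).compl
      rintro a (rfl | ha)
      · exact hij
      · exact lt_trans ha hij
  · obtain ⟨i, hi⟩ := hdet fun m => {n | m ≤ g n}
    exact ⟨i, hle i g hi hg⟩

end Construction

section ClosingOff

open Cardinal

variable {κ : Cardinal.{0}}

theorem exists_bound_of_mk_lt (hreg : κ.IsRegular) (A : Set κ.ord.ToType) (hA : #A < κ) :
    ∃ b, ∀ a ∈ A, a < b := by
  have h : ¬ IsCofinal A := fun h => by
    have := Order.cof_le h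
    rw [Ordinal.cof_toType, hreg.cof_ord] at this
    exact this.not_gt hA
  obtain ⟨b, hb⟩ := not_isCofinal_iff.1 h
  exact ⟨b, hb⟩

/-- A closing-off argument: a countable family of sets is determined by an initial segment. -/
theorem exists_determined_Iio {I : Type} [LinearOrder I] [WellFoundedLT I] (hκ : ℵ₀ < κ)
    (hIio : ∀ b : I, #(Iio b) < κ)
    (hbdd : ∀ A : Set I, #A < κ → ∃ b, ∀ a ∈ A, a < b) {f : I → ℕ → ℕ} {D : Filter ℕ}
    (hD : IsIndependentMod f D) (hmax : ∀ D' ≤ D, IsIndependentMod f D' → D' = D)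
    (X : ℕ → Set ℕ) : ∃ i : I, ∀ m, Determined f D (Iio i) (X m) := by
  classical
  have hT : ∀ (m : ℕ) (s : Finset (I × ℕ)), ∃ t, IsFunctional s → s ⊆ t ∧ IsFunctional t ∧
      (Forces f D t (X m) ∨ Forces f D t (X m)ᶜ) := fun m s => by
    by_cases hs : IsFunctional s
    · exact (exists_decides hD hmax hs (X m)).imp fun t ht _ => ht
    · exact ⟨∅, fun h => absurd h hs⟩
  choose T hT using hT
  have hfin : ∀ s : Finset (I × ℕ), ∃ b, ∀ p ∈ s, p.1 < b := fun s => by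
    obtain ⟨b, hb⟩ := hbdd (s.image Prod.fst : Finset I)
      ((lt_aleph0_of_finite _).trans hκ)
    exact ⟨b, fun p hp => hb _ (by simpa using ⟨p.2, hp⟩)⟩
  choose c hc using hfin
  have hnext : ∀ b : I, ∃ b', b < b' ∧ ∀ m s, (∀ p ∈ s, p.1 < b) → ∀ p ∈ T m s, p.1 < b' := by
    intro b
    let e : (Iio b) × ℕ → I × ℕ := fun x => (x.1, x.2)
    obtain ⟨b', hb'⟩ := hbdd (insert b (range fun x : ℕ × Finset ((Iio b) × ℕ) =>
        c (T x.1 (x.2.image e)))) (by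
      refine (mk_insert_le).trans_lt (add_lt_of_lt hκ.le (mk_range_le.trans_lt ?_)
        (one_lt_aleph0.trans hκ))
      rw [mk_prod, lift_id, lift_id]
      refine mul_lt_of_lt hκ.le (mk_nat.trans_lt hκ) ?_
      rcases finite_or_infinite ((Iio b) × ℕ) with h | h
      · exact (lt_aleph0_of_finite _).trans hκ
      · rw [mk_finset_of_infinite, mk_prod, lift_id, lift_id]
        exact mul_lt_of_lt hκ.le (hIio b) (mk_nat.trans_lt hκ))
    refine ⟨b', hb' _ (mem_insert _ _), fun m s hs p hp => (hc _ p hp).trans (hb' _ (Or.inr ?_))⟩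
    have hsub : (s : Set (I × ℕ)) ⊆ e '' univ := fun q hq => ⟨(⟨q.1, hs q hq⟩, q.2), trivial, rfl⟩
    obtain ⟨s', -, rfl⟩ := Finset.subset_set_image_iff.1 hsub
    exact ⟨(m, s'), rfl⟩
  choose next hlt hnext using hnext
  obtain ⟨b₀, -⟩ := hbdd ∅ (by simpa using (aleph0_pos.trans hκ))
  let b : ℕ → I := fun n => next^[n] b₀
  have hb : ∀ n, b (n + 1) = next (b n) := fun n => Function.iterate_succ_apply' _ _ _
  have hmono : Monotone b := monotone_nat_of_le_succ fun n => (hb n).symm ▸ (hlt (b n)).le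
  have hne : {i | ∀ n, b n < i}.Nonempty := by
    obtain ⟨i, hi⟩ := hbdd (range b)
      ((mk_le_aleph0_iff.2 (countable_range b).to_subtype).trans_lt hκ)
    exact ⟨i, fun n => hi _ (mem_range_self n)⟩
  -- The least strict upper bound `i` of the sequence `b` is closed under the functions `T m`.
  obtain ⟨i, hi, hmin⟩ := wellFounded_lt.has_min _ hne
  have hlub : ∀ j < i, ∃ n, j < b n := by
    intro j hj
    by_contra! hcon
    exact hmin j (fun n => lt_of_lt_of_le (by rw [hb]; exact hlt _) (hcon (n + 1))) hj
  refine ⟨i, fun m => determined_of_decides hD fun s hs hsi => ⟨T m s, (hT m s hs).1,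
    (hT m s hs).2.1, ?_, (hT m s hs).2.2⟩⟩
  have hn : ∃ n, ∀ p ∈ s, p.1 < b n := by
    choose! N hN using hlub
    refine ⟨s.sup fun p => N p.1, fun p hp => (hN p.1 (hsi p hp)).trans_le (hmono ?_)⟩
    exact Finset.le_sup (f := fun p : I × ℕ => N p.1) hp
  obtain ⟨n, hn⟩ := hn
  intro p hp
  exact (hnext (b n) m s hn p hp).trans (by rw [← hb]; exact hi (n + 1))

/-- For every regular cardinal `κ` with `ℵ₀ < κ ≤ 2 ^ ℵ₀` there is an ultrafilter on `ω` for which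
the infinite elements of the ultrapower of `ω` have coinitiality `κ`. -/
theorem exists_ultrafilter_coinitial (hκ : ℵ₀ < κ) (hreg : κ.IsRegular) (hc : κ ≤ continuum) :
    ∃ (u : Ultrafilter ℕ) (f : κ.ord.ToType → ℕ → ℕ), (∀ i k, ∀ᶠ n in u, k < f i n) ∧
      (∀ i j, i < j → ∀ᶠ n in u, f j n ≤ f i n) ∧
      ∀ g : ℕ → ℕ, (∀ m, ∀ᶠ n in u, m ≤ g n) → ∃ i, ∀ᶠ n in u, f i n ≤ g n := by
  classical
  have hemb : #κ.ord.ToType ≤ #(ℕ → Bool) := by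
    rw [mk_ord_toType]
    simpa using hc
  obtain ⟨e⟩ := hemb
  obtain ⟨f₀, hf₀⟩ := exists_independent_functions
  let f : κ.ord.ToType → ℕ → ℕ := fun i => f₀ (e i)
  have hf : ∀ s, IsFunctional s → (cylinder f s).Nonempty := by
    intro s hs
    obtain ⟨n, hn⟩ := hf₀ (s.image fun p => (e p.1, p.2)) (by
      intro p hp q hq hpq
      simp only [Finset.mem_image] at hp hq
      obtain ⟨p, hp, rfl⟩ := hp
      obtain ⟨q, hq, rfl⟩ := hq
      exact hs p hp q hq (e.injective hpq))
    exact ⟨n, fun p hp => hn (e p.1, p.2) (Finset.mem_image_of_mem _ hp)⟩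
  obtain ⟨D, hD, hmax⟩ := exists_maximal_filter hf
  obtain ⟨u, h1, h2, h3⟩ := exists_ultrafilter_of_determined hD hmax
    (exists_determined_Iio hκ (fun b => (mk_Iio_lt b (by simp)).trans_eq (mk_ord_toType κ))
      (exists_bound_of_mk_lt hreg) hD hmax)
  exact ⟨u, f, h1, h2, h3⟩

end ClosingOff

/-! ### The order of the ultrapower of the unit interval in the fiber -/

section Sets

/-- The graph of a sequence in `[0,1]`, as a subset of `𝕄`. -/
def graphSet (a : ℕ → unitInterval) : Set Mioid := {p | p.2 = a p.1}

/-- The part of `𝕄` on or below a sequence. -/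
def lowerSet (a : ℕ → unitInterval) : Set Mioid := {p | p.2 ≤ a p.1}

/-- The part of `𝕄` on or above a sequence. -/
def upperSet (a : ℕ → unitInterval) : Set Mioid := {p | a p.1 ≤ p.2}

theorem continuous_comp_fst (a : ℕ → unitInterval) : Continuous fun p : Mioid => a p.1 :=
  continuous_of_discreteTopology.comp continuous_fst

theorem isClosed_graphSet (a : ℕ → unitInterval) : IsClosed (graphSet a) :=
  isClosed_eq continuous_snd (continuous_comp_fst a)

theorem isClosed_lowerSet (a : ℕ → unitInterval) : IsClosed (lowerSet a) :=
  isClosed_le continuous_snd (continuous_comp_fst a)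

theorem isClosed_upperSet (a : ℕ → unitInterval) : IsClosed (upperSet a) :=
  isClosed_le (continuous_comp_fst a) continuous_snd

theorem lowerSet_inter_upperSet (a : ℕ → unitInterval) :
    lowerSet a ∩ upperSet a = graphSet a := by
  ext p
  exact (le_antisymm_iff (a := p.2) (b := a p.1)).symm

theorem lowerSet_union_upperSet (a : ℕ → unitInterval) : lowerSet a ∪ upperSet a = univ := by
  ext p
  simpa [lowerSet, upperSet] using le_total _ _

end Sets

namespace IsFiberLattice

variable {u : Ultrafilter ℕ} {X : Type*} [TopologicalSpace X] {F : Set Mioid → Set X}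

/-- Reversing the unit interval turns one fiber lattice into another. -/
theorem reverse (hF : IsFiberLattice u F) :
    IsFiberLattice u fun C => F (Prod.map id unitInterval.symm ⁻¹' C) := by
  have hc : Continuous (Prod.map id unitInterval.symm : Mioid → Mioid) := by fun_prop
  have hpre : ∀ (n : ℕ) (C : Set Mioid), Prod.mk n ⁻¹' (Prod.map id unitInterval.symm ⁻¹' C) =
      unitInterval.symm ⁻¹' (Prod.mk n ⁻¹' C) := fun _ _ => rfl
  have hinv : ∀ C : Set Mioid, Prod.map id unitInterval.symm ⁻¹'
      (Prod.map id unitInterval.symm ⁻¹' C) = C := fun C => by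
    ext ⟨n, t⟩
    simp
  refine ⟨fun C hC => hF.isClosed _ (hC.preimage hc), fun C D hC hD => ?_, fun C D => ?_,
    fun C hC => ?_, fun C hC h => ?_, fun p q hpq => ?_⟩
  · rw [preimage_inter, hF.inter _ _ (hC.preimage hc) (hD.preimage hc)]
  · rw [preimage_union, hF.union]
  · rw [hF.eq_empty_iff _ (hC.preimage hc)]
    simp only [hpre, preimage_eq_empty_iff, unitInterval.symm_involutive.surjective.range_eq,
      disjoint_univ]
  · exact hF.eq_univ _ (hC.preimage hc) (h.mono fun n hn => by rw [hpre, hn, preimage_univ])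
  · obtain ⟨C, D, hC, hD, h, hp, hq⟩ := hF.separates p q hpq
    exact ⟨_, _, hC.preimage hc, hD.preimage hc, by rw [← preimage_union, h, preimage_univ],
      by rwa [hinv], by rwa [hinv]⟩

theorem union_eq_univ (hF : IsFiberLattice u F) {C D : Set Mioid} (h : C ∪ D = univ) :
    F C ∪ F D = univ := by
  rw [← hF.union, h]
  exact hF.eq_univ _ isClosed_univ (by simp)

theorem empty (hF : IsFiberLattice u F) : F ∅ = ∅ :=
  (hF.eq_empty_iff ∅ isClosed_empty).2 (by simp)

theorem t2Space (hF : IsFiberLattice u F) : T2Space X := by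
  refine ⟨fun p q hpq => ?_⟩
  obtain ⟨C, D, hC, hD, h, hp, hq⟩ := hF.separates p q hpq
  refine ⟨(F C)ᶜ, (F D)ᶜ, (hF.isClosed C hC).isOpen_compl, (hF.isClosed D hD).isOpen_compl,
    hp, hq, Set.disjoint_left.2 fun x hx hx' => ?_⟩
  have : x ∈ F C ∪ F D := by rw [hF.union_eq_univ h]; trivial
  exact this.elim hx hx'

/-- The sets `F C` contain a neighbourhood base of each point. -/
theorem exists_mem_subset [CompactSpace X] (hF : IsFiberLattice u F) {x : X} {V : Set X}
    (hV : IsOpen V) (hx : x ∈ V) :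
    ∃ C, IsClosed C ∧ x ∈ F C ∧ F C ⊆ V ∧ F C ∈ 𝓝 x := by
  have h : ∀ y, ∃ C D, IsClosed C ∧ IsClosed D ∧ (y ∈ Vᶜ → C ∪ D = univ ∧ x ∉ F C ∧ y ∉ F D) := by
    intro y
    by_cases hy : y ∈ Vᶜ
    · obtain ⟨C, D, hC, hD, h⟩ := hF.separates x y fun h => hy (h ▸ hx)
      exact ⟨C, D, hC, hD, fun _ => h⟩
    · exact ⟨∅, ∅, isClosed_empty, isClosed_empty, fun h => absurd h hy⟩
  choose C D hC hD h using h
  obtain ⟨t, ht, htV⟩ := hV.isClosed_compl.isCompact.elim_nhds_subcover (fun y => (F (D y))ᶜ)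
    fun y hy => (hF.isClosed _ (hD y)).isOpen_compl.mem_nhds (h y hy).2.2
  have hclosed : ∀ s : Finset X, IsClosed (⋂ y ∈ s, D y) := fun s =>
    isClosed_biInter fun y _ => hD y
  have hFI : ∀ s : Finset X, F (⋂ y ∈ s, D y) = ⋂ y ∈ s, F (D y) := by
    classical
    intro s
    induction s using Finset.induction_on with
    | empty => simpa using hF.eq_univ _ isClosed_univ (by simp)
    | insert y s _ ih =>
      rw [Finset.set_biInter_insert, Finset.set_biInter_insert, hF.inter _ _ (hD y) (hclosed s), ih]
  have hnhds : F (⋂ y ∈ t, D y) ∈ 𝓝 x := by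
    rw [hFI, Filter.biInter_finset_mem]
    intro y hy
    refine mem_of_superset ((hF.isClosed _ (hC y)).isOpen_compl.mem_nhds (h y (ht y hy)).2.1)
      fun z hz => ?_
    have : z ∈ F (C y) ∪ F (D y) := by rw [hF.union_eq_univ (h y (ht y hy)).1]; trivial
    exact this.resolve_left hz
  refine ⟨⋂ y ∈ t, D y, hclosed t, mem_of_mem_nhds hnhds, ?_, hnhds⟩
  intro z hz
  by_contra hzV
  obtain ⟨y, hy, hzy⟩ := mem_iUnion₂.1 (htV hzV)
  rw [hFI] at hz
  exact hzy (mem_iInter₂.1 hz y hy)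

/-- By compactness, the sets `F C` also interpolate between closed and open sets. -/
theorem exists_subset_subset [CompactSpace X] (hF : IsFiberLattice u F) {K V : Set X}
    (hK : IsClosed K) (hV : IsOpen V) (hKV : K ⊆ V) :
    ∃ C, IsClosed C ∧ K ⊆ F C ∧ F C ⊆ V := by
  have h : ∀ x, ∃ C, IsClosed C ∧ (x ∈ K → F C ⊆ V ∧ F C ∈ 𝓝 x) := by
    intro x
    by_cases hx : x ∈ K
    · obtain ⟨C, hC, -, h⟩ := hF.exists_mem_subset hV (hKV hx)
      exact ⟨C, hC, fun _ => h⟩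
    · exact ⟨∅, isClosed_empty, fun h => absurd h hx⟩
  choose C hC h using h
  obtain ⟨t, ht, htK⟩ := hK.isCompact.elim_nhds_subcover (fun x => F (C x)) fun x hx => (h x hx).2
  have hFU : ∀ s : Finset X, F (⋃ y ∈ s, C y) = ⋃ y ∈ s, F (C y) := by
    classical
    intro s
    induction s using Finset.induction_on with
    | empty => simpa using hF.empty
    | insert y s _ ih =>
      rw [Finset.set_biUnion_insert, Finset.set_biUnion_insert, hF.union, ih]
  refine ⟨⋃ y ∈ t, C y, isClosed_biUnion_finset fun y _ => hC y, ?_, ?_⟩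
  · rw [hFU]; exact htK
  · rw [hFU]; exact iUnion₂_subset fun y hy => (h y (ht y hy)).1

theorem exists_eq_singleton (hF : IsFiberLattice u F) (a : ℕ → unitInterval) :
    ∃ x, F (graphSet a) = {x} := by
  have hne : (F (graphSet a)).Nonempty := by
    rw [nonempty_iff_ne_empty]
    intro h
    rw [hF.eq_empty_iff _ (isClosed_graphSet a)] at h
    obtain ⟨n, hn⟩ := h.exists
    have : a n ∈ Prod.mk n ⁻¹' graphSet a := rfl
    rw [hn] at this
    exact this
  refine exists_eq_singleton_iff_nonempty_subsingleton.2 ⟨hne, fun x hx y hy => ?_⟩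
  by_contra hxy
  obtain ⟨C, D, hC, hD, h, hxC, hyD⟩ := hF.separates x y hxy
  have h1 : (∀ᶠ n in u, Prod.mk n ⁻¹' graphSet a ⊆ Prod.mk n ⁻¹' C) ∨
      ∀ᶠ n in u, Prod.mk n ⁻¹' graphSet a ⊆ Prod.mk n ⁻¹' D := by
    rw [← Ultrafilter.eventually_or]
    refine Eventually.of_forall fun n => ?_
    have : (n, a n) ∈ C ∪ D := by rw [h]; trivial
    refine this.imp (fun h => ?_) fun h => ?_ <;>
    · rintro t (rfl : t = a n)
      exact h
  rcases h1 with h1 | h1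
  · exact hxC ((hF.subset_iff (isClosed_graphSet a) hC).2 h1 hx)
  · exact hyD ((hF.subset_iff (isClosed_graphSet a) hD).2 h1 hy)

/-- The point of the fiber that corresponds to a member of the ultrapower of `[0,1]`. -/
noncomputable def pt (hF : IsFiberLattice u F) (a : ℕ → unitInterval) : X :=
  (hF.exists_eq_singleton a).choose

theorem graphSet_eq (hF : IsFiberLattice u F) (a : ℕ → unitInterval) :
    F (graphSet a) = {hF.pt a} := (hF.exists_eq_singleton a).choose_spec

theorem pt_mem_iff (hF : IsFiberLattice u F) {a : ℕ → unitInterval} {C : Set Mioid}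
    (hC : IsClosed C) : hF.pt a ∈ F C ↔ ∀ᶠ n in u, (n, a n) ∈ C := by
  rw [← singleton_subset_iff, ← hF.graphSet_eq, hF.subset_iff (isClosed_graphSet a) hC]
  refine eventually_congr (Eventually.of_forall fun n => ⟨fun h => h rfl, ?_⟩)
  rintro h t (rfl : t = a n)
  exact h

theorem pt_notMem_lowerSet (hF : IsFiberLattice u F) {a b : ℕ → unitInterval} :
    hF.pt b ∉ F (lowerSet a) ↔ ∀ᶠ n in u, a n < b n := by
  rw [hF.pt_mem_iff (isClosed_lowerSet a), ← Ultrafilter.eventually_not]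
  simp [lowerSet]

theorem pt_notMem_upperSet (hF : IsFiberLattice u F) {a b : ℕ → unitInterval} :
    hF.pt a ∉ F (upperSet b) ↔ ∀ᶠ n in u, a n < b n := by
  rw [hF.pt_mem_iff (isClosed_upperSet b), ← Ultrafilter.eventually_not]
  simp [upperSet]

theorem lowerSet_inter_upperSet (hF : IsFiberLattice u F) (a : ℕ → unitInterval) :
    F (lowerSet a) ∩ F (upperSet a) = {hF.pt a} := by
  rw [← hF.inter _ _ (isClosed_lowerSet a) (isClosed_upperSet a),
    StandardSubcontinua.lowerSet_inter_upperSet, hF.graphSet_eq]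

theorem mem_lowerSet_or (hF : IsFiberLattice u F) (a : ℕ → unitInterval) (x : X) :
    x ∈ F (lowerSet a) ∨ x ∈ F (upperSet a) := by
  have : x ∈ F (lowerSet a) ∪ F (upperSet a) := by
    rw [hF.union_eq_univ (lowerSet_union_upperSet a)]; trivial
  exact this

theorem lowerSet_mono (hF : IsFiberLattice u F) {a b : ℕ → unitInterval}
    (h : ∀ᶠ n in u, a n ≤ b n) : F (lowerSet a) ⊆ F (lowerSet b) :=
  (hF.subset_iff (isClosed_lowerSet a) (isClosed_lowerSet b)).2
    (h.mono fun _ hn _ ht => le_trans ht hn)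

theorem upperSet_anti (hF : IsFiberLattice u F) {a b : ℕ → unitInterval}
    (h : ∀ᶠ n in u, a n ≤ b n) : F (upperSet b) ⊆ F (upperSet a) :=
  (hF.subset_iff (isClosed_upperSet b) (isClosed_upperSet a)).2
    (h.mono fun _ hn _ ht => le_trans hn ht)

theorem eventually_lt_of_notMem (hF : IsFiberLattice u F) {a b : ℕ → unitInterval} {x : X}
    (ha : x ∉ F (lowerSet a)) (hb : x ∉ F (upperSet b)) : ∀ᶠ n in u, a n < b n := by
  by_contra h
  rw [← Ultrafilter.eventually_not] at h
  exact ha (hF.lowerSet_mono (h.mono fun n hn => not_lt.1 hn)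
    ((hF.mem_lowerSet_or b x).resolve_right hb))

theorem exists_pt_mem [CompactSpace X] (hF : IsFiberLattice u F) {V : Set X} (hV : IsOpen V)
    (hne : V.Nonempty) : ∃ a, hF.pt a ∈ V := by
  obtain ⟨x, hx⟩ := hne
  obtain ⟨C, hC, hxC, hCV, -⟩ := hF.exists_mem_subset hV hx
  have h1 : ¬ ∀ᶠ n in u, Prod.mk n ⁻¹' C = ∅ := fun h => by
    rw [← hF.eq_empty_iff C hC] at h
    rw [h] at hxC
    exact hxC
  rw [← Ultrafilter.eventually_not] at h1
  have h2 : ∀ n, ∃ t : unitInterval, ¬ Prod.mk n ⁻¹' C = ∅ → (n, t) ∈ C := fun n => by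
    by_cases hn : Prod.mk n ⁻¹' C = ∅
    · exact ⟨0, fun h => absurd hn h⟩
    · obtain ⟨t, ht⟩ := nonempty_iff_ne_empty.2 hn
      exact ⟨t, fun _ => ht⟩
  choose a ha using h2
  exact ⟨a, hCV ((hF.pt_mem_iff hC).2 (h1.mono fun n hn => ha n hn))⟩

theorem reverse_lowerSet (a : ℕ → unitInterval) :
    Prod.map id unitInterval.symm ⁻¹' lowerSet a = upperSet fun n => unitInterval.symm (a n) := by
  ext ⟨n, t⟩
  exact unitInterval.symm_le_comm

theorem reverse_upperSet (a : ℕ → unitInterval) :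
    Prod.map id unitInterval.symm ⁻¹' upperSet a = lowerSet fun n => unitInterval.symm (a n) := by
  ext ⟨n, t⟩
  exact unitInterval.le_symm_comm

/-- Ultraproducts of intervals are connected. -/
theorem isPreconnected_inter [CompactSpace X] (hF : IsFiberLattice u F) (a b : ℕ → unitInterval) :
    IsPreconnected (F (upperSet a ∩ lowerSet b)) := by
  have := hF.t2Space
  have hcl := (isClosed_upperSet a).inter (isClosed_lowerSet b)
  have hS := hF.isClosed _ hcl
  rw [isPreconnected_iff_subset_of_disjoint_closed]
  intro t t' ht ht' hcov hdis
  set S := F (upperSet a ∩ lowerSet b) with hSdef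
  -- Enlarge the two pieces to disjoint sets of the form `F C`, and split almost all intervals.
  have hd : Disjoint (S ∩ t) (S ∩ t') := by
    rw [disjoint_iff_inter_eq_empty, ← inter_inter_distrib_left, hdis]
  obtain ⟨V, V', hV, hV', hsub, hsub', hVV⟩ :=
    normal_separation (hS.inter ht) (hS.inter ht') hd
  obtain ⟨C, hC, h1, h2⟩ := hF.exists_subset_subset (hS.inter ht) hV hsub
  obtain ⟨C', hC', h1', h2'⟩ := hF.exists_subset_subset (hS.inter ht') hV' hsub'
  have hCC : F (C ∩ C') = ∅ := by
    rw [hF.inter _ _ hC hC', ← disjoint_iff_inter_eq_empty]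
    exact hVV.mono h2 h2'
  have hSC : S ⊆ F (C ∪ C') := by
    rw [hF.union]
    exact fun x hx => (hcov hx).imp (fun h => h1 ⟨hx, h⟩) fun h => h1' ⟨hx, h⟩
  rw [hF.eq_empty_iff _ (hC.inter hC')] at hCC
  rw [hSdef, hF.subset_iff hcl (hC.union hC')] at hSC
  have key : (∀ᶠ n in u, Prod.mk n ⁻¹' (upperSet a ∩ lowerSet b) ⊆ Prod.mk n ⁻¹' C) ∨
      ∀ᶠ n in u, Prod.mk n ⁻¹' (upperSet a ∩ lowerSet b) ⊆ Prod.mk n ⁻¹' C' := by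
    rw [← Ultrafilter.eventually_or]
    filter_upwards [hCC, hSC] with n hn1 hn2
    have hcon : IsPreconnected (Icc (a n) (b n)) := isPreconnected_Icc
    rw [isPreconnected_iff_subset_of_disjoint_closed] at hcon
    refine hcon _ _ (isClosed_mioid_iff.1 hC n) (isClosed_mioid_iff.1 hC' n) hn2 ?_
    rw [← preimage_inter, hn1, inter_empty]
  rcases key with h | h
  · left
    rw [← hF.subset_iff hcl hC] at h
    intro x hx
    refine (hcov hx).resolve_right fun hxt => ?_
    exact Set.disjoint_left.1 hVV (h2 (h hx)) (hsub' ⟨hx, hxt⟩)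
  · right
    rw [← hF.subset_iff hcl hC'] at h
    intro x hx
    refine (hcov hx).resolve_left fun hxt => ?_
    exact Set.disjoint_left.1 hVV (hsub ⟨hx, hxt⟩) (h2' (h hx))

theorem isPreconnected_lowerSet [CompactSpace X] (hF : IsFiberLattice u F) (a : ℕ → unitInterval) :
    IsPreconnected (F (lowerSet a)) := by
  have : upperSet (fun _ => 0) ∩ lowerSet a = lowerSet a :=
    inter_eq_right.2 fun p _ => unitInterval.nonneg'
  rw [← this]
  exact hF.isPreconnected_inter _ _

theorem isPreconnected_upperSet [CompactSpace X] (hF : IsFiberLattice u F) (a : ℕ → unitInterval) :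
    IsPreconnected (F (upperSet a)) := by
  have : upperSet a ∩ lowerSet (fun _ => 1) = upperSet a :=
    inter_eq_left.2 fun p _ => unitInterval.le_one'
  rw [← this]
  exact hF.isPreconnected_inter _ _

theorem preconnectedSpace [CompactSpace X] (hF : IsFiberLattice u F) : PreconnectedSpace X := by
  refine ⟨?_⟩
  have : F (upperSet fun _ => 0) = univ :=
    hF.eq_univ _ (isClosed_upperSet _) (Eventually.of_forall fun n =>
      eq_univ_of_forall fun t => unitInterval.nonneg')
  rw [← this]
  exact hF.isPreconnected_upperSet _

end IsFiberLattice

/-! ### Cut points -/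

section CutPoints

variable {X : Type*} [TopologicalSpace X]

/-- The point `c` separates `x` from `y`: these lie in different parts of a partition of the
complement of `c` into two open sets. -/
def Separates (c x y : X) : Prop :=
  ∃ U V : Set X, IsOpen U ∧ IsOpen V ∧ U ∪ V = {c}ᶜ ∧ Disjoint U V ∧ x ∈ U ∧ y ∈ V

/-- The point `c` is a cut point: its complement is disconnected. -/
def IsCutPoint (c : X) : Prop := ∃ x y, Separates c x y

theorem Separates.isCutPoint {c x y : X} (h : Separates c x y) : IsCutPoint c := ⟨x, y, h⟩

theorem Separates.symm {c x y : X} : Separates c x y → Separates c y x := by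
  rintro ⟨U, V, hU, hV, h, hd, hx, hy⟩
  exact ⟨V, U, hV, hU, by rwa [union_comm], hd.symm, hy, hx⟩

/-- The order on the fiber: `x` lies strictly below and `y` strictly above some member of the
ultrapower of `[0,1]`. -/
def Below (F : Set Mioid → Set X) (x y : X) : Prop :=
  ∃ a, x ∉ F (upperSet a) ∧ y ∉ F (lowerSet a)

end CutPoints

namespace IsFiberLattice

variable {u : Ultrafilter ℕ} {X : Type*} [TopologicalSpace X] {F : Set Mioid → Set X}

theorem below_trans (hF : IsFiberLattice u F) {x y z : X} (h : Below F x y) (h' : Below F y z) :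
    Below F x z := by
  obtain ⟨a, hx, hy⟩ := h
  obtain ⟨b, hy', hz⟩ := h'
  exact ⟨a, hx, fun hza => hz (hF.lowerSet_mono
    ((hF.eventually_lt_of_notMem hy hy').mono fun _ h => h.le) hza)⟩

theorem below_irrefl (hF : IsFiberLattice u F) (x : X) : ¬ Below F x x := by
  rintro ⟨a, h1, h2⟩
  exact (hF.mem_lowerSet_or a x).elim h2 h1

theorem below_asymm (hF : IsFiberLattice u F) {x y : X} (h : Below F x y) : ¬ Below F y x :=
  fun h' => hF.below_irrefl x (hF.below_trans h h')

omit [TopologicalSpace X] in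
theorem below_reverse {x y : X} :
    Below (fun C => F (Prod.map id unitInterval.symm ⁻¹' C)) x y ↔ Below F y x := by
  simp only [Below, reverse_lowerSet, reverse_upperSet]
  constructor
  · rintro ⟨a, h1, h2⟩
    exact ⟨_, h2, h1⟩
  · rintro ⟨a, h1, h2⟩
    refine ⟨fun n => unitInterval.symm (a n), ?_, ?_⟩ <;>
      simpa only [unitInterval.symm_symm]

theorem separates_pt (hF : IsFiberLattice u F) {x y : X} {a : ℕ → unitInterval}
    (hx : x ∉ F (upperSet a)) (hy : y ∉ F (lowerSet a)) : Separates (hF.pt a) x y := by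
  refine ⟨(F (upperSet a))ᶜ, (F (lowerSet a))ᶜ, (hF.isClosed _ (isClosed_upperSet a)).isOpen_compl,
    (hF.isClosed _ (isClosed_lowerSet a)).isOpen_compl, ?_, ?_, hx, hy⟩
  · rw [← compl_inter, inter_comm, hF.lowerSet_inter_upperSet]
  · exact Set.disjoint_left.2 fun z h1 h2 => (hF.mem_lowerSet_or a z).elim h2 h1

theorem notMem_upperSet_of_mem (hF : IsFiberLattice u F) {c : X} {U V : Set X}
    (hdis : Disjoint U V) (hUV : U ∪ V = {c}ᶜ)
    (hA : ∀ a, c ∉ F (lowerSet a) → F (lowerSet a) ⊆ U) {a : ℕ → unitInterval}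
    (ha : hF.pt a ∈ V) : c ∉ F (upperSet a) := by
  intro hc
  have hne : hF.pt a ≠ c := by
    have : hF.pt a ∈ ({c}ᶜ : Set X) := hUV ▸ Or.inr ha
    exact this
  have h1 : c ∉ F (lowerSet a) := fun h => by
    have : c ∈ F (lowerSet a) ∩ F (upperSet a) := ⟨h, hc⟩
    rw [hF.lowerSet_inter_upperSet] at this
    exact hne this.symm
  refine Set.disjoint_left.1 hdis (hA a h1 ?_) ha
  rw [hF.pt_mem_iff (isClosed_lowerSet a)]
  exact Eventually.of_forall fun n => le_refl (a n)

theorem notMem_lowerSet_of_mem (hF : IsFiberLattice u F) {c : X} {U V : Set X}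
    (hdis : Disjoint U V) (hUV : U ∪ V = {c}ᶜ)
    (hB : ∀ a, c ∉ F (upperSet a) → F (upperSet a) ⊆ V) {a : ℕ → unitInterval}
    (ha : hF.pt a ∈ U) : c ∉ F (lowerSet a) := by
  intro hc
  have hne : hF.pt a ≠ c := by
    have : hF.pt a ∈ ({c}ᶜ : Set X) := hUV ▸ Or.inl ha
    exact this
  have h1 : c ∉ F (upperSet a) := fun h => by
    have : c ∈ F (lowerSet a) ∩ F (upperSet a) := ⟨hc, h⟩
    rw [hF.lowerSet_inter_upperSet] at this
    exact hne this.symm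
  refine Set.disjoint_left.1 hdis ha (hB a h1 ?_)
  rw [hF.pt_mem_iff (isClosed_upperSet a)]
  exact Eventually.of_forall fun n => le_refl (a n)

/-- One of the two parts of the complement of a cut point contains everything
below it, and the other one contains everything above it. -/
theorem orient [CompactSpace X] (hF : IsFiberLattice u F) {c : X} {U V : Set X} (hU : IsOpen U)
    (hV : IsOpen V) (hUV : U ∪ V = {c}ᶜ) (hdis : Disjoint U V) (hUne : U.Nonempty)
    (hVne : V.Nonempty) :
    ((∀ a, c ∉ F (lowerSet a) → F (lowerSet a) ⊆ U) ∧
      ∀ a, c ∉ F (upperSet a) → F (upperSet a) ⊆ V) ∨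
    ((∀ a, c ∉ F (lowerSet a) → F (lowerSet a) ⊆ V) ∧
      ∀ a, c ∉ F (upperSet a) → F (upperSet a) ⊆ U) := by
  -- A family of connected sets with a common point is contained in one of the two parts.
  have side : ∀ (S : (ℕ → unitInterval) → Set X) (e : X), (∀ a, IsPreconnected (S a)) →
      (∀ a, e ∈ S a) → (∀ a, c ∉ S a → S a ⊆ U) ∨ ∀ a, c ∉ S a → S a ⊆ V := by
    intro S e hS he
    have h1 : ∀ a, c ∉ S a → S a ⊆ U ∨ S a ⊆ V := fun a hc =>
      IsPreconnected.subset_or_subset hU hV hdis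
        (by rw [hUV]; exact fun x hx h => hc (h ▸ hx)) (hS a)
    by_cases heU : e ∈ U
    · exact Or.inl fun a hc => (h1 a hc).resolve_right fun h =>
        Set.disjoint_left.1 hdis heU (h (he a))
    · exact Or.inr fun a hc => (h1 a hc).resolve_left fun h => heU (h (he a))
  have hlow := side (fun a => F (lowerSet a)) (hF.pt fun _ => 0) hF.isPreconnected_lowerSet
    fun a => (hF.pt_mem_iff (isClosed_lowerSet a)).2 (Eventually.of_forall fun n =>
      unitInterval.nonneg')
  have hupp := side (fun a => F (upperSet a)) (hF.pt fun _ => 1) hF.isPreconnected_upperSet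
    fun a => (hF.pt_mem_iff (isClosed_upperSet a)).2 (Eventually.of_forall fun n =>
      unitInterval.le_one')
  -- The points of the ultrapower are dense, so neither part can avoid them.
  have hno : ∀ {U V : Set X}, IsOpen V → V.Nonempty → U ∪ V = {c}ᶜ → Disjoint U V →
      (∀ a, c ∉ F (lowerSet a) → F (lowerSet a) ⊆ U) →
      ¬ ∀ a, c ∉ F (upperSet a) → F (upperSet a) ⊆ U := by
    intro U V hV hVne hUV hdis hA hB
    obtain ⟨a, ha⟩ := hF.exists_pt_mem hV hVne
    have h1 := hF.notMem_upperSet_of_mem hdis hUV hA ha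
    refine Set.disjoint_left.1 hdis (hB a h1 ?_) ha
    rw [hF.pt_mem_iff (isClosed_upperSet a)]
    exact Eventually.of_forall fun n => le_refl (a n)
  rcases hlow with hl | hl <;> rcases hupp with hu | hu
  · exact (hno hV hVne hUV hdis hl hu).elim
  · exact Or.inl ⟨hl, hu⟩
  · exact Or.inr ⟨hl, hu⟩
  · exact (hno hU hUne (by rwa [union_comm]) hdis.symm hl hu).elim

theorem inter_nonempty_of_mem [CompactSpace X] (hF : IsFiberLattice u F) {c : X} {U V O : Set X}
    (hU : IsOpen U) (hV : IsOpen V) (hUV : U ∪ V = {c}ᶜ) (hdis : Disjoint U V)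
    (hVne : V.Nonempty) (hO : IsOpen O) (hc : c ∈ O) : (O ∩ V).Nonempty := by
  have := hF.preconnectedSpace
  by_contra hcon
  rw [not_nonempty_iff_eq_empty] at hcon
  have hVc : Vᶜ = U ∪ O := by
    ext x
    constructor
    · intro hx
      by_cases hxc : x = c
      · exact Or.inr (hxc ▸ hc)
      · have : x ∈ U ∪ V := by rw [hUV]; exact hxc
        exact Or.inl (this.resolve_right hx)
    · rintro (hx | hx) hxV
      · exact Set.disjoint_left.1 hdis hx hxV
      · have : x ∈ O ∩ V := ⟨hx, hxV⟩
        rw [hcon] at this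
        exact this
  have hclopen : IsClopen V := ⟨⟨by rw [hVc]; exact hU.union hO⟩, hV⟩
  rcases isClopen_iff.1 hclopen with h | h
  · exact hVne.ne_empty h
  · have : c ∈ ({c}ᶜ : Set X) := by rw [← hUV, h]; exact Or.inr trivial
    exact this rfl

/-- A cut point on the lower side of the cut point `c` lies below `c`, and one
on the upper side lies above `c`. -/
theorem below_of_mem [CompactSpace X] (hF : IsFiberLattice u F) {c c' : X} {U V : Set X}
    (hU : IsOpen U) (hV : IsOpen V) (hUV : U ∪ V = {c}ᶜ) (hdis : Disjoint U V)
    (hA : ∀ a, c ∉ F (lowerSet a) → F (lowerSet a) ⊆ U)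
    (hB : ∀ a, c ∉ F (upperSet a) → F (upperSet a) ⊆ V) (hc' : IsCutPoint c') :
    (c' ∈ U → Below F c' c) ∧ (c' ∈ V → Below F c c') := by
  obtain ⟨U', V', hU', hV', hUV', hdis', hUne', hVne', hA', hB'⟩ :
      ∃ U' V' : Set X, IsOpen U' ∧ IsOpen V' ∧ U' ∪ V' = {c'}ᶜ ∧ Disjoint U' V' ∧
        U'.Nonempty ∧ V'.Nonempty ∧ (∀ a, c' ∉ F (lowerSet a) → F (lowerSet a) ⊆ U') ∧
        ∀ a, c' ∉ F (upperSet a) → F (upperSet a) ⊆ V' := by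
    obtain ⟨x, y, U', V', hU', hV', hUV', hdis', hx, hy⟩ := hc'
    rcases hF.orient hU' hV' hUV' hdis' ⟨x, hx⟩ ⟨y, hy⟩ with ⟨h1, h2⟩ | ⟨h1, h2⟩
    · exact ⟨U', V', hU', hV', hUV', hdis', ⟨x, hx⟩, ⟨y, hy⟩, h1, h2⟩
    · exact ⟨V', U', hV', hU', by rwa [union_comm], hdis'.symm, ⟨y, hy⟩, ⟨x, hx⟩, h1, h2⟩
  constructor
  · intro hc
    obtain ⟨a, ha, ha'⟩ := hF.exists_pt_mem (hU.inter hV')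
      (hF.inter_nonempty_of_mem hU' hV' hUV' hdis' hVne' hU hc)
    exact ⟨a, hF.notMem_upperSet_of_mem hdis' hUV' hA' ha',
      hF.notMem_lowerSet_of_mem hdis hUV hB ha⟩
  · intro hc
    obtain ⟨a, ha, ha'⟩ := hF.exists_pt_mem (hV.inter hU')
      (hF.inter_nonempty_of_mem hV' hU' (by rwa [union_comm]) hdis'.symm hUne' hV hc)
    exact ⟨a, hF.notMem_upperSet_of_mem hdis hUV hA ha,
      hF.notMem_lowerSet_of_mem hdis' hUV' hB' ha'⟩

theorem below_or_below [CompactSpace X] (hF : IsFiberLattice u F) {c c' : X} (hc : IsCutPoint c)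
    (hc' : IsCutPoint c') (hne : c ≠ c') : Below F c c' ∨ Below F c' c := by
  obtain ⟨x, y, U, V, hU, hV, hUV, hdis, hx, hy⟩ := hc
  have hmem : c' ∈ U ∪ V := by rw [hUV]; exact hne.symm
  rcases hF.orient hU hV hUV hdis ⟨x, hx⟩ ⟨y, hy⟩ with ⟨h1, h2⟩ | ⟨h1, h2⟩
  · have h := hF.below_of_mem hU hV hUV hdis h1 h2 hc'
    exact hmem.elim (fun hm => Or.inr (h.1 hm)) fun hm => Or.inl (h.2 hm)
  · have h := hF.below_of_mem hV hU (by rwa [union_comm]) hdis.symm h1 h2 hc'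
    exact hmem.elim (fun hm => Or.inl (h.2 hm)) fun hm => Or.inr (h.1 hm)

/-- Among cut points, separation is betweenness. -/
theorem below_of_separates [CompactSpace X] (hF : IsFiberLattice u F) {c x y : X}
    (h : Separates c x y) (hx : IsCutPoint x) (hy : IsCutPoint y) :
    (Below F x c ∧ Below F c y) ∨ (Below F y c ∧ Below F c x) := by
  obtain ⟨U, V, hU, hV, hUV, hdis, hxU, hyV⟩ := h
  rcases hF.orient hU hV hUV hdis ⟨x, hxU⟩ ⟨y, hyV⟩ with ⟨h1, h2⟩ | ⟨h1, h2⟩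
  · exact Or.inl ⟨(hF.below_of_mem hU hV hUV hdis h1 h2 hx).1 hxU,
      (hF.below_of_mem hU hV hUV hdis h1 h2 hy).2 hyV⟩
  · have hVU : V ∪ U = {c}ᶜ := by rwa [union_comm]
    exact Or.inr ⟨(hF.below_of_mem hV hU hVU hdis.symm h1 h2 hy).1 hyV,
      (hF.below_of_mem hV hU hVU hdis.symm h1 h2 hx).2 hxU⟩

theorem below_and_below [CompactSpace X] (hF : IsFiberLattice u F) {c x y : X}
    (h : Separates c x y) (hx : IsCutPoint x) (hy : IsCutPoint y) (hxy : Below F x y) :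
    Below F x c ∧ Below F c y :=
  (hF.below_of_separates h hx hy).resolve_right fun h' =>
    hF.below_asymm hxy (hF.below_trans h'.1 h'.2)

end IsFiberLattice

/-! ### A topological invariant of the fibers -/

open Cardinal in
/-- The invariant that distinguishes fibers. In it `p` is a monotone sequence of cut points and `Q`
is a family of at most `ℵ₁` cut points beyond `p`, none of which is nearest to `p`; the invariant
says that two different cut points always separate `p` from `Q`. Asking for two points excludes the
case that only the gap itself, as a point of the completed order, lies in between. -/
def SequencesSeparated (X : Type) [TopologicalSpace X] : Prop :=
  ∀ (p : ℕ → X) (Q : Set X), #Q ≤ ℵ_ 1 → Q.Nonempty → (∀ n, IsCutPoint (p n)) →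
    (∀ q ∈ Q, IsCutPoint q) → (∀ m n, m < n → ∀ q ∈ Q, Separates (p n) (p m) q) →
    (∀ q ∈ Q, ∃ q' ∈ Q, ∀ n, Separates q' (p n) q) →
    ∃ r r', r ≠ r' ∧ ∀ n, ∀ q ∈ Q, Separates r (p n) q ∧ Separates r' (p n) q

open Cardinal in
/-- Every family of at most `ℵ₁` infinite elements of the ultrapower of `ω` has an
infinite lower bound. -/
def BoundsInfiniteFamilies (v : Ultrafilter ℕ) : Prop :=
  ∀ G : Set (ℕ → ℕ), #G ≤ ℵ_ 1 → (∀ g ∈ G, ∀ m, ∀ᶠ n in v, m ≤ g n) →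
    ∃ h : ℕ → ℕ, (∀ m, ∀ᶠ n in v, m ≤ h n) ∧ ∀ g ∈ G, ∀ᶠ n in v, h n ≤ g n

/-- Overspill: countably many conditions that hold almost everywhere hold up to some infinite
index. -/
theorem exists_infinite_forall_le {v : Filter ℕ} (hv : v ≤ atTop) {R : ℕ → ℕ → Prop}
    (hR : ∀ j, ∀ᶠ n in v, R j n) :
    ∃ g : ℕ → ℕ, (∀ m, ∀ᶠ n in v, m ≤ g n) ∧ ∀ᶠ n in v, ∀ j ≤ g n, R j n := by
  classical
  refine ⟨fun n => Nat.findGreatest (fun k => ∀ j ≤ k, R j n) n, fun m => ?_, ?_⟩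
  · have h1 : ∀ᶠ n in v, ∀ j ∈ Finset.range (m + 1), R j n :=
      (Finset.eventually_all _).2 fun j _ => hR j
    filter_upwards [h1, hv (eventually_ge_atTop m)] with n hn hmn
    exact Nat.le_findGreatest hmn fun j hj => hn j (Finset.mem_range.2 (by omega))
  · filter_upwards [hR 0] with n hn
    exact Nat.findGreatest_spec (P := fun k => ∀ j ≤ k, R j n) (Nat.zero_le n)
      fun j hj => by rwa [Nat.le_zero.1 hj]

open Cardinal in
/-- An increasing sequence in the ultrapower of `[0,1]` and at most `ℵ₁` upper bounds of it can be
separated, by evaluating the sequence at a suitable infinite index. -/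
theorem BoundsInfiniteFamilies.exists_between {v : Ultrafilter ℕ} (hB : BoundsInfiniteFamilies v)
    (hv : (v : Filter ℕ) ≤ atTop) {a : ℕ → ℕ → unitInterval} {B : Set (ℕ → unitInterval)}
    (hBc : #B ≤ ℵ_ 1) (ha : ∀ j, ∀ᶠ n in v, a j n < a (j + 1) n)
    (hab : ∀ b ∈ B, ∀ j, ∀ᶠ n in v, a j n < b n) :
    ∃ c : ℕ → unitInterval, (∀ j, ∀ᶠ n in v, a j n < c n) ∧ ∀ b ∈ B, ∀ᶠ n in v, c n < b n := by
  obtain ⟨g₀, hg₀, hg₀'⟩ := exists_infinite_forall_le hv ha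
  choose g hg hg' using fun b : B => exists_infinite_forall_le hv (hab b b.2)
  obtain ⟨h, hh, hle⟩ := hB (insert g₀ (range g)) (by
      refine mk_insert_le.trans (add_le_of_le (aleph0_le_aleph 1) (mk_range_le.trans hBc) ?_)
      exact one_le_aleph0.trans (aleph0_le_aleph 1))
    (by rintro _ (rfl | ⟨b, rfl⟩); exacts [hg₀, hg b])
  refine ⟨fun n => a (h n) n, fun j => ?_, fun b hb => ?_⟩
  · filter_upwards [hh (j + 1), hg₀', hle g₀ (mem_insert _ _)] with n h1 h2 h3
    have key : ∀ k, j + 1 ≤ k → k ≤ h n → a j n < a k n := by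
      intro k hk
      induction k, hk using Nat.le_induction with
      | base => intro hj; exact h2 j (by omega)
      | succ k hk ih => intro hk'; exact (ih (by omega)).trans (h2 k (by omega))
    exact key _ h1 le_rfl
  · filter_upwards [hg' ⟨b, hb⟩, hle (g ⟨b, hb⟩) (Or.inr ⟨_, rfl⟩)] with n h1 h2
    exact h1 _ h2

namespace IsFiberLattice

open Cardinal

variable {u : Ultrafilter ℕ} {X : Type} [TopologicalSpace X] {F : Set Mioid → Set X}

/-- The invariant holds for increasing sequences, if the ultrafilter bounds families of
size `ℵ₁`. -/
theorem exists_separates_of_below [CompactSpace X] (hF : IsFiberLattice u F)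
    (hu : (u : Filter ℕ) ≤ atTop) (hB : BoundsInfiniteFamilies u) {p : ℕ → X} {Q : Set X}
    (hQ : #Q ≤ ℵ_ 1) (hpc : ∀ n, IsCutPoint (p n)) (hQc : ∀ q ∈ Q, IsCutPoint q)
    (hsep : ∀ m n, m < n → ∀ q ∈ Q, Separates (p n) (p m) q)
    (hnext : ∀ q ∈ Q, ∃ q' ∈ Q, ∀ n, Separates q' (p n) q) (h01 : Below F (p 0) (p 1))
    (hne : Q.Nonempty) :
    ∃ r r', r ≠ r' ∧ ∀ n, ∀ q ∈ Q, Separates r (p n) q ∧ Separates r' (p n) q := by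
  have h0q : ∀ q ∈ Q, Below F (p 0) q := by
    intro q hq
    rcases hF.below_of_separates (hsep 0 1 one_pos q hq) (hpc 0) (hQc q hq) with h | h
    · exact hF.below_trans h.1 h.2
    · exact (hF.below_asymm h01 h.2).elim
  have hnq : ∀ n, ∀ q ∈ Q, Below F (p n) q := by
    intro n q hq
    rcases Nat.eq_zero_or_pos n with rfl | hn
    · exact h0q q hq
    · exact (hF.below_and_below (hsep 0 n hn q hq) (hpc 0) (hQc q hq) (h0q q hq)).2
  have hmn : ∀ n, Below F (p n) (p (n + 1)) := by
    intro n
    obtain ⟨q, hq⟩ := hne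
    exact (hF.below_and_below (hsep n (n + 1) n.lt_succ_self q hq) (hpc n) (hQc q hq)
      (hnq n q hq)).1
  choose a ha ha' using hmn
  have hqb : ∀ q : Q, ∃ b, q.1 ∉ F (lowerSet b) ∧ ∀ n, ∀ᶠ i in u, a n i < b i := by
    rintro ⟨q, hq⟩
    obtain ⟨q', hq', hs⟩ := hnext q hq
    have h1 := fun n => hF.below_and_below (hs n) (hpc n) (hQc q hq) (hnq n q hq)
    obtain ⟨b, hb, hb'⟩ := (h1 0).2
    refine ⟨b, hb', fun n => ?_⟩
    obtain ⟨d, hd, hd'⟩ := (h1 (n + 1)).1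
    filter_upwards [hF.eventually_lt_of_notMem (ha' n) hd, hF.eventually_lt_of_notMem hd' hb]
      with i h1 h2
    exact h1.trans h2
  choose b hb hab using hqb
  have haa : ∀ n, ∀ᶠ i in u, a n i < a (n + 1) i := fun n =>
    hF.eventually_lt_of_notMem (ha' n) (ha (n + 1))
  obtain ⟨c, hac, hcb⟩ := hB.exists_between hu (B := range b) (mk_range_le.trans hQ) haa
    (by rintro _ ⟨q, rfl⟩; exact hab q)
  obtain ⟨c', hac', hcb'⟩ := hB.exists_between hu (B := insert c (range b))
    (mk_insert_le.trans (add_le_of_le (aleph0_le_aleph 1) (mk_range_le.trans hQ)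
      (one_le_aleph0.trans (aleph0_le_aleph 1)))) haa
    (by rintro _ (rfl | ⟨q, rfl⟩); exacts [hac, hab q])
  have key : ∀ c : ℕ → unitInterval, (∀ j, ∀ᶠ n in u, a j n < c n) →
      (∀ q, ∀ᶠ n in u, c n < b q n) → ∀ n, ∀ q ∈ Q, Separates (hF.pt c) (p n) q := by
    intro c hac hcb n q hq
    exact hF.separates_pt (fun h => ha n (hF.upperSet_anti ((hac n).mono fun _ h => h.le) h))
      fun h => hb ⟨q, hq⟩ (hF.lowerSet_mono ((hcb ⟨q, hq⟩).mono fun _ h => h.le) h)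
  refine ⟨hF.pt c, hF.pt c', fun h => ?_, fun n q hq => ⟨key c hac (fun q => hcb _ ⟨q, rfl⟩) n q hq,
    key c' hac' (fun q => hcb' _ (Or.inr ⟨q, rfl⟩)) n q hq⟩⟩
  have h1 : hF.pt c' ∉ F (upperSet c) := hF.pt_notMem_upperSet.2 (hcb' c (mem_insert _ _))
  rw [← h, hF.pt_notMem_upperSet] at h1
  obtain ⟨n, hn⟩ := h1.exists
  exact lt_irrefl _ hn

theorem sequencesSeparated [CompactSpace X] (hF : IsFiberLattice u F)
    (hu : (u : Filter ℕ) ≤ atTop) (hB : BoundsInfiniteFamilies u) : SequencesSeparated X := by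
  intro p Q hQ hne hpc hQc hsep hnext
  obtain ⟨q, hq⟩ := hne
  rcases hF.below_of_separates (hsep 0 1 one_pos q hq) (hpc 0) (hQc q hq) with h | h
  · exact hF.exists_separates_of_below hu hB hQ hpc hQc hsep hnext h.1 ⟨q, hq⟩
  · exact hF.reverse.exists_separates_of_below hu hB hQ hpc hQc hsep hnext
      (below_reverse.2 h.2) ⟨q, hq⟩

/-- If `ℵ₁` functions are coinitial among the infinite functions modulo `u`, the sequence of the
points `1 / (n + 2)` and the corresponding family of infinitesimals violate the invariant. -/
theorem not_sequencesSeparated [CompactSpace X] (hF : IsFiberLattice u F) {I : Type} [Nonempty I]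
    (hI : #I ≤ ℵ_ 1) {f : I → ℕ → ℕ} (hf : ∀ i k, ∀ᶠ n in u, k < f i n)
    (hcoinit : ∀ g : ℕ → ℕ, (∀ m, ∀ᶠ n in u, m ≤ g n) → ∃ i, ∀ᶠ n in u, f i n ≤ g n) :
    ¬ SequencesSeparated X := by
  intro hX
  let e : ℕ → unitInterval := fun k => ⟨1 / (k + 2), by positivity, by
    rw [div_le_one (by positivity)]; linarith [(k.cast_nonneg : (0 : ℝ) ≤ k)]⟩
  have he : ∀ {k l : ℕ}, k < l → e l < e k := by
    intro k l hkl
    change (1 : ℝ) / (l + 2) < 1 / (k + 2)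
    have : (k : ℝ) < l := by exact_mod_cast hkl
    exact one_div_lt_one_div_of_lt (by positivity) (by linarith)
  have he0 : ∀ k, (0 : unitInterval) < e k := fun k => by
    change (0 : ℝ) < 1 / (k + 2)
    positivity
  have he1 : ∀ k, e k < (1 : unitInterval) := fun k => by
    change (1 : ℝ) / (k + 2) < 1
    rw [div_lt_one (by positivity)]
    linarith [(k.cast_nonneg : (0 : ℝ) ≤ k)]
  have hsep : ∀ {a b c : ℕ → unitInterval}, (∀ᶠ n in u, a n < b n) → (∀ᶠ n in u, b n < c n) →
      Separates (hF.pt b) (hF.pt c) (hF.pt a) := fun h h' =>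
    (hF.separates_pt (hF.pt_notMem_upperSet.2 h) (hF.pt_notMem_lowerSet.2 h')).symm
  have hcut : ∀ g : ℕ → ℕ, IsCutPoint (hF.pt fun n => e (g n)) := fun g =>
    (hsep (a := fun _ => 0) (c := fun _ => 1) (Eventually.of_forall fun n => he0 _)
      (Eventually.of_forall fun n => he1 _)).isCutPoint
  obtain ⟨r, r', hrr, hr⟩ := hX (fun k => hF.pt fun _ => e k)
    (range fun i => hF.pt fun n => e (f i n)) (mk_range_le.trans hI) (range_nonempty _)
    (fun k => hcut fun _ => k) (by rintro _ ⟨i, rfl⟩; exact hcut (f i))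
    (by
      rintro k l hkl _ ⟨i, rfl⟩
      exact hsep ((hf i l).mono fun n hn => he hn) (Eventually.of_forall fun n => he hkl))
    (by
      rintro _ ⟨i, rfl⟩
      obtain ⟨j, hj⟩ := hcoinit (fun n => f i n - 1) fun m =>
        (hf i m).mono fun n hn => by omega
      refine ⟨_, ⟨j, rfl⟩, fun k => hsep ?_ ((hf j k).mono fun n hn => he hn)⟩
      filter_upwards [hj, hf i 0] with n h1 h2
      exact he (by omega))
  obtain ⟨i₀⟩ := ‹Nonempty I›
  have hrc : IsCutPoint r := (hr 0 _ ⟨i₀, rfl⟩).1.isCutPoint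
  have hrc' : IsCutPoint r' := (hr 0 _ ⟨i₀, rfl⟩).2.isCutPoint
  have hqp : ∀ i k, Below F (hF.pt fun n => e (f i n)) (hF.pt fun _ => e k) := fun i k =>
    ⟨fun _ => e (k + 1), hF.pt_notMem_upperSet.2 ((hf i (k + 1)).mono fun n hn => he hn),
      hF.pt_notMem_lowerSet.2 (Eventually.of_forall fun n => he k.lt_succ_self)⟩
  have hbetween : ∀ s : X, (∀ k, ∀ q ∈ range (fun i => hF.pt fun n => e (f i n)),
      Separates s (hF.pt fun _ => e k) q) → ∀ i k,
      Below F (hF.pt fun n => e (f i n)) s ∧ Below F s (hF.pt fun _ => e k) := fun s hs i k =>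
    hF.below_and_below (hs k _ ⟨i, rfl⟩).symm (hcut (f i)) (hcut fun _ => k) (hqp i k)
  have hr1 := hbetween r fun k q hq => (hr k q hq).1
  have hr2 := hbetween r' fun k q hq => (hr k q hq).2
  -- An element `c` of the ultrapower between `r` and `r'` is a positive infinitesimal
  -- below all `1 / (f i + 2)`, so that `1 / c` contradicts coinitiality.
  have key : ∀ s s' : X, (∀ i k, Below F (hF.pt fun n => e (f i n)) s ∧
      Below F s (hF.pt fun _ => e k)) → (∀ i k, Below F (hF.pt fun n => e (f i n)) s' ∧
      Below F s' (hF.pt fun _ => e k)) → ¬ Below F s s' := by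
    rintro s s' h1 h2 ⟨c, hsc, hsc'⟩
    have hfc : ∀ i, ∀ᶠ n in u, e (f i n) < c n := by
      intro i
      obtain ⟨d, hd, hd'⟩ := (h1 i 0).1
      filter_upwards [hF.pt_notMem_upperSet.1 hd, hF.eventually_lt_of_notMem hd' hsc] with n h3 h4
      exact h3.trans h4
    have hce : ∀ k, ∀ᶠ n in u, c n < e k := by
      intro k
      obtain ⟨d, hd, hd'⟩ := (h2 i₀ k).2
      filter_upwards [hF.pt_notMem_lowerSet.1 hd', hF.eventually_lt_of_notMem hsc' hd] with n h3 h4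
      exact h4.trans h3
    obtain ⟨i, hi⟩ := hcoinit (fun n => ⌊1 / (c n : ℝ)⌋₊ - 2) fun m => by
      filter_upwards [hce m, hfc i₀] with n h3 h4
      have hpos : (0 : ℝ) < c n := (he0 _).trans h4
      have h5 : (c n : ℝ) < 1 / (m + 2) := h3
      have h6 : ((m + 2 : ℕ) : ℝ) ≤ 1 / (c n : ℝ) := by
        rw [lt_div_iff₀ (by positivity)] at h5
        rw [le_div_iff₀ hpos]
        push_cast
        linarith
      have := Nat.le_floor h6
      omega
    obtain ⟨n, h3, h4, h5⟩ := (hi.and ((hf i 0).and (hfc i))).exists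
    have hpos : (0 : ℝ) < c n := (he0 _).trans h5
    have h6 : f i n + 2 ≤ ⌊1 / (c n : ℝ)⌋₊ := by omega
    have h7 : ((f i n + 2 : ℕ) : ℝ) ≤ 1 / (c n : ℝ) :=
      (Nat.le_floor_iff (by positivity)).1 h6
    have h8 : (1 : ℝ) / (f i n + 2) < c n := h5
    rw [div_lt_iff₀ (by positivity)] at h8
    rw [le_div_iff₀ hpos] at h7
    push_cast at h7
    linarith
  rcases hF.below_or_below hrc hrc' hrr with h | h
  · exact key r r' hr1 hr2 h
  · exact key r' r hr2 hr1 h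

end IsFiberLattice

/-! ### Nonhomeomorphic fibers without the Continuum Hypothesis -/

section NotContinuumHypothesis

open Cardinal

theorem notMem_range_pure_of_forall_lt {u : Ultrafilter ℕ} {f : ℕ → ℕ}
    (hf : ∀ k, ∀ᶠ n in u, k < f n) :
    u ∉ range (pure : ℕ → Ultrafilter ℕ) := by
  rintro ⟨n, rfl⟩
  have : f n < f n := by simpa using hf (f n)
  exact lt_irrefl _ this

/-- If the Continuum Hypothesis fails, there are ultrafilters for which the coinitialities of the
infinite elements of the ultrapower of `ω` are `ℵ₁` and `ℵ₂`, and the corresponding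
fibers are distinguished by `SequencesSeparated`. -/
theorem exists_not_homeomorph (hCH : ¬ ContinuumHypothesis) :
    ∃ u v : OmegaStar, IsEmpty (IFiber u ≃ₜ IFiber v) := by
  have h1 : ℵ_ 1 < continuum := by
    refine lt_of_le_of_ne aleph_one_le_continuum fun h => hCH h.symm
  have h2 : ℵ_ 2 ≤ continuum := by
    have : (ℵ_ 2 : Cardinal.{0}) = Order.succ (ℵ_ 1) := by
      rw [succ_aleph, one_add_one_eq_two]
    rw [this]
    exact Order.succ_le_of_lt h1
  have hreg : (ℵ_ 2 : Cardinal.{0}).IsRegular := by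
    have := isRegular_aleph_add_one 1
    rwa [one_add_one_eq_two] at this
  have h12 : (ℵ_ 1 : Cardinal.{0}) < ℵ_ 2 := aleph_lt_aleph.2 (by norm_num)
  obtain ⟨u, f, hf, -, hfc⟩ := exists_ultrafilter_coinitial (κ := ℵ_ 1) aleph0_lt_aleph_one
    isRegular_aleph_one h1.le
  obtain ⟨v, g, hg, hgm, hgc⟩ := exists_ultrafilter_coinitial (κ := ℵ_ 2)
    (aleph0_lt_aleph_one.trans h12) hreg h2
  have : Nonempty (ℵ_ 1 : Cardinal.{0}).ord.ToType := by
    rw [← mk_ne_zero_iff, mk_ord_toType]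
    exact (aleph0_pos.trans aleph0_lt_aleph_one).ne'
  obtain ⟨i₁⟩ := this
  obtain ⟨i₂, -⟩ := exists_bound_of_mk_lt hreg ∅
    (by simpa using aleph0_pos.trans (aleph0_lt_aleph_one.trans h12))
  have : Nonempty (ℵ_ 1 : Cardinal.{0}).ord.ToType := ⟨i₁⟩
  let u' : OmegaStar := ⟨u, notMem_range_pure_of_forall_lt (hf i₁)⟩
  let v' : OmegaStar := ⟨v, notMem_range_pure_of_forall_lt (hg i₂)⟩
  refine ⟨u', v', ⟨fun e => ?_⟩⟩
  obtain ⟨_, F, hF⟩ := exists_isFiberLattice_IFiber u'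
  obtain ⟨_, G, hG⟩ := exists_isFiberLattice_IFiber v'
  have hB : BoundsInfiniteFamilies v := by
    intro A hA hAinf
    choose i hi using fun a : A => hgc a (hAinf a a.2)
    obtain ⟨j, hj⟩ := exists_bound_of_mk_lt hreg (range i) ((mk_range_le.trans hA).trans_lt h12)
    refine ⟨g j, fun m => (hg j m).mono fun n h => h.le, fun a ha => ?_⟩
    filter_upwards [hi ⟨a, ha⟩, hgm _ _ (hj _ ⟨⟨a, ha⟩, rfl⟩)] with n h3 h4
    exact h4.trans h3
  exact hF.not_sequencesSeparated (by rw [mk_ord_toType]) hf hfc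
    ((hG.preimage e).sequencesSeparated (le_atTop_of_omegaStar v') hB)

end NotContinuumHypothesis

/-! ### The equivalences -/

theorem continuumHypothesis_iff_IFiber : ContinuumHypothesis ↔
    ∀ u v : OmegaStar, Nonempty (IFiber u ≃ₜ IFiber v) := by
  constructor
  · intro hCH u v
    obtain ⟨_, F, hF⟩ := exists_isFiberLattice_IFiber u
    obtain ⟨_, G, hG⟩ := exists_isFiberLattice_IFiber v
    exact nonempty_homeomorph_of_continuumHypothesis hCH (le_atTop_of_omegaStar u)
      (le_atTop_of_omegaStar v) hF hG
  · intro h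
    by_contra hCH
    obtain ⟨u, v, he⟩ := exists_not_homeomorph hCH
    exact (h u v).elim he.false

theorem forall_IFiber_iff_forall_isStandardSubcontinuum :
    (∀ u v : OmegaStar, Nonempty (IFiber u ≃ₜ IFiber v)) ↔
      ∀ S T : Set HalfLineStar, IsStandardSubcontinuum S → IsStandardSubcontinuum T →
        Nonempty (S ≃ₜ T) := by
  constructor
  · rintro h _ _ ⟨a, b, u, hab, hI, rfl⟩ ⟨a', b', v, hab', hI', rfl⟩
    obtain ⟨e⟩ := nonempty_homeomorph_ultraLimit_IFiber hab hI u
    obtain ⟨e'⟩ := nonempty_homeomorph_ultraLimit_IFiber hab' hI' v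
    obtain ⟨e''⟩ := h u v
    exact ⟨(e.trans e'').trans e'.symm⟩
  · intro h u v
    have hab : ∀ n : ℕ, (2 * n : ℝ≥0) < 2 * n + 1 := fun n => lt_add_one _
    obtain ⟨e⟩ := nonempty_homeomorph_ultraLimit_IFiber hab isDiscreteSeq_Icc_even u
    obtain ⟨e'⟩ := nonempty_homeomorph_ultraLimit_IFiber hab isDiscreteSeq_Icc_even v
    obtain ⟨e''⟩ := h _ _ ⟨_, _, u, hab, isDiscreteSeq_Icc_even, rfl⟩
      ⟨_, _, v, hab, isDiscreteSeq_Icc_even, rfl⟩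
    exact ⟨(e.symm.trans e'').trans e'⟩

end StandardSubcontinua

theorem mainTheorem2 :
    (ContinuumHypothesis ↔
      ∀ u v : OmegaStar, Nonempty (IFiber u ≃ₜ IFiber v)) ∧
    (ContinuumHypothesis ↔
      ∀ S T : Set HalfLineStar, IsStandardSubcontinuum S → IsStandardSubcontinuum T →
        Nonempty (S ≃ₜ T)) :=
  ⟨StandardSubcontinua.continuumHypothesis_iff_IFiber,
    StandardSubcontinua.continuumHypothesis_iff_IFiber.trans
      StandardSubcontinua.forall_IFiber_iff_forall_isStandardSubcontinuum⟩
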